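/- Consider a slotted system with a base station with $L$ antennas, total transmission power $P>0$, and $L$ single-antenna users with SNR threshold $\theta>0$. In slot $t=0,1,2,\dots$ the channel vectors are $\mathbf h_1(t),\dots,\mathbf h_L(t)\in\mathbb C^L$, all of whose coefficients (over users, antennas and slots) are i.i.d. $\mathcal{CN}(0,1)$. Packets for user $\ell$ wait in queue $\ell$ (infinite buffer); $Q_\ell(t)\in\mathbb N$ is its length and $\mathbf q(t)=(Q_1(t),\dots,Q_L(t))$. The vectors $\mathbf A(t)\in\mathbb N^L$ of the numbers of packets arriving in the slots are i.i.d. over $t$ with finite mean $\boldsymbol\lambda=\mathbb E[\mathbf A(t)]$ (the arrival-rate vector) and $\Pr(\mathbf A(t)=\mathbf 0)>0$; the entries of $\mathbf A(t)$ may be dependent. Arrivals, channels and the (arbitrary) initial queue lengths are independent. A control policy is a function $\pi:\mathbb N^L\to\mathcal V=\{0,1\}^L$; in slot $t$ the queues indicated by $\mathbf v=\pi(\mathbf q(t))$ are scheduled, $k=\|\mathbf v\|_1$ of them. With equal power allocation and zero-forcing beamforming with perfect channel knowledge, the SNR of a scheduled user $\ell$ is $\frac Pk\max_{\mathbf f}|\mathbf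 f^\dagger\mathbf h_\ell(t)|^2$, the maximum being over unit vectors $\mathbf f$ orthogonal to the channel vectors of the other scheduled users. One packet leaves each scheduled nonempty queue whose SNR is at least $\theta$ (otherwise it is kept for retransmission), and then the packets $\mathbf A(t)$ join the queues, which gives $\mathbf q(t+1)$. For $0\le k\le L$ let $$d(k)=\frac{\Gamma\left(L-k+1,\,k\theta/P\right)}{\Gamma(L-k+1)},\qquad \Gamma(a,b)=\int_b^\infty t^{a-1}e^{-t}\,dt .$$ The stability region $\mathcal C$ is the set of all $\boldsymbol\lambda\in\mathbb R_+^L$ such that $\boldsymbol\lambda\preceq\sum_{\mathbf v\in\mathcal V}p_{\mathbf v}\,d(\|\mathbf v\|_1)\,\mathbf v$ (componentwise) for some probability vector $(p_{\mathbf v})_{\mathbf v\in\mathcal V}$. Queue $\ell$ is stable if, for some function $F$, $\lim_{t\to\infty}\Pr(Q_\ell(t)<x)=F(x)$ for every $x\in\mathbb R$ and $\lim_{x\to\infty}F(x)=1$. A policy stabilizes all queues at $\boldsymbol\lambda$ if all $L$ queues are stable for all arrival laws as above with rate vector $\boldsymbol\lambda$ and all laws of the initial queue lengths. Let $\pi$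 be any policy such that, for every $\mathbf q\in\mathbb N^L$, $$\pi(\mathbf q)\in\arg\max_{\mathbf v\in\mathcal V} d(\|\mathbf v\|_1)\,\mathbf v^T\mathbf q .$$ Then $\pi$ stabilizes all $L$ queues at every arrival-rate vector of the stability region $\mathcal C$, stability on the boundary being understood, as usual, in the sense of closure. Precisely: 1. $\pi$ stabilizes all $L$ queues at every $\boldsymbol\lambda\in\mathbb R_+^L$ for which some $\boldsymbol\lambda'\in\mathcal C$ satisfies $\lambda_\ell<\lambda'_\ell$ for all $\ell$; 2. $\mathcal C$ is contained in the closure of the set of all $\boldsymbol\lambda\in\mathbb R_+^L$ at which $\pi$ stabilizes all $L$ queues. -/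

import Mathlib

open MeasureTheory ProbabilityTheory Filter Topology

universe u

noncomputable section

namespace SDMA

/-- A complex channel matrix; the row `h ℓ` is the channel vector of user `ℓ` (one entry per antenna). -/
abbrev Channel (L : ℕ) : Type := Fin L → Fin L → ℂ

/-- The circularly symmetric complex Gaussian law `CN(0,1)`: independent real and imaginary parts,
each centred Gaussian of variance `1/2`. -/
def stdComplexGaussian : Measure ℂ :=
  ((gaussianReal 0 (1 / 2)).prod (gaussianReal 0 (1 / 2))).map
    (fun z : ℝ × ℝ => (⟨z.1, z.2⟩ : ℂ))

/-- The channel vector of user `ℓ`, as a vector of the Hilbert space `ℂ^L`. -/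
def channelVec {L : ℕ} (h : Channel L) (ℓ : Fin L) : EuclideanSpace ℂ (Fin L) :=
  WithLp.toLp 2 (h ℓ)

/-- The span of the channel vectors of the scheduled users other than `ℓ`. -/
def interferenceSpace {L : ℕ} (h : Channel L) (v : Finset (Fin L)) (ℓ : Fin L) :
    Submodule ℂ (EuclideanSpace ℂ (Fin L)) :=
  Submodule.span ℂ {x | ∃ m ∈ v, m ≠ ℓ ∧ x = channelVec h m}

/-- The effective channel power `|f_ℓ† h_ℓ|²` of zero-forcing beamforming with perfect channel
knowledge: `f_ℓ` is a unit vector orthogonal to the channels of the other scheduled users, and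
maximizes the received power under this constraint. (For `ℓ ∈ v` the constraint set is a nonempty
compact set, so that the supremum is a maximum.) -/
def zfPower {L : ℕ} (h : Channel L) (v : Finset (Fin L)) (ℓ : Fin L) : ℝ :=
  sSup {g : ℝ | ∃ f : EuclideanSpace ℂ (Fin L),
    f ∈ (interferenceSpace h v ℓ)ᗮ ∧ ‖f‖ = 1 ∧ g = ‖inner ℂ f (channelVec h ℓ)‖ ^ 2}

/-- The receive SNR of user `ℓ` when the set `v` is scheduled and the total power `P` is shared
equally by the scheduled users (unit noise variance). -/
def snr {L : ℕ} (P : ℝ) (h : Channel L) (v : Finset (Fin L)) (ℓ : Fin L) : ℝ :=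
  P / (v.card : ℝ) * zfPower h v ℓ

/-- The upper incomplete gamma function. -/
def upperGamma (a b : ℝ) : ℝ := ∫ t in Set.Ioi b, t ^ (a - 1) * Real.exp (-t)

/-- The departure rate `d(k)` of each of `k` scheduled queues (`k ≤ L`). -/
def depRate (L : ℕ) (P θ : ℝ) (k : ℕ) : ℝ :=
  upperGamma ((L : ℝ) - k + 1) (k * θ / P) / Real.Gamma ((L : ℝ) - k + 1)

/-- The departure-rate vector `d(|v|) v` of the control decision `v`. -/
def depVec {L : ℕ} (P θ : ℝ) (v : Finset (Fin L)) (ℓ : Fin L) : ℝ :=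
  if ℓ ∈ v then depRate L P θ v.card else 0

/-- The stability region: the union, over all probability vectors `p` on the control decisions, of
the sets of nonnegative rate vectors that are componentwise at most `∑ v, p v • d(|v|) v`. -/
def stabilityRegion (L : ℕ) (P θ : ℝ) : Set (Fin L → ℝ) :=
  {r | ∃ p : Finset (Fin L) → ℝ, (∀ v, 0 ≤ p v) ∧ ∑ v, p v = 1 ∧
    ∀ ℓ, 0 ≤ r ℓ ∧ r ℓ ≤ ∑ v, p v * depVec P θ v ℓ}

/-- A control policy: in each slot, the queue lengths determine the set of scheduled queues. -/
abbrev Policy (L : ℕ) : Type := (Fin L → ℕ) → Finset (Fin L)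

/-- The objective `d(|v|) vᵀ q`. -/
def weight {L : ℕ} (P θ : ℝ) (q : Fin L → ℕ) (v : Finset (Fin L)) : ℝ :=
  depRate L P θ v.card * ∑ ℓ ∈ v, (q ℓ : ℝ)

/-- The policy schedules a maximizer of `d(|v|) vᵀ q` (ties are broken in an arbitrary way). -/
def IsMaxWeight {L : ℕ} (P θ : ℝ) (π : Policy L) : Prop :=
  ∀ q v, weight P θ q v ≤ weight P θ q (π q)

open Classical in
/-- The queue lengths under the policy `π` for given initial lengths `q₀`, arrivals `a t` and
channels `h t`. In slot `t` one packet of each scheduled nonempty queue is transmitted; it leaves the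
queue if the SNR is at least `θ` and is kept for retransmission otherwise. The packets `a t` that
arrive during slot `t` can be transmitted from slot `t + 1` on. -/
def queueLength {L : ℕ} (P θ : ℝ) (π : Policy L) (q₀ : Fin L → ℕ) (a : ℕ → Fin L → ℕ)
    (h : ℕ → Channel L) : ℕ → Fin L → ℕ
  | 0 => q₀
  | t + 1 => fun ℓ =>
      let q := queueLength P θ π q₀ a h t
      (q ℓ - if ℓ ∈ π q ∧ θ ≤ snr P (h t) (π q) ℓ then 1 else 0) + a t ℓ

/-- A sequence of random queue lengths is stable: the probabilities `Pr(X t < x)` converge as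
`t → ∞`, and their limit `F x` tends to `1` as `x → ∞`. -/
def IsStable {Ω : Type u} [MeasurableSpace Ω] (μ : Measure Ω) (X : ℕ → Ω → ℕ) : Prop :=
  ∃ F : ℝ → ℝ, (∀ x : ℝ, Tendsto (fun t => μ.real {ω | (X t ω : ℝ) < x}) atTop (𝓝 (F x))) ∧
    Tendsto F atTop (𝓝 1)

/-- The random inputs of the system, for the arrival-rate vector `r`. The channel coefficients are
i.i.d. `CN(0,1)` over users, antennas and slots. The vectors of the numbers of packets that arrive in
the successive slots are i.i.d. with mean `r` and vanish with positive probability; their entries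
may depend on each other. Arrivals, channels and initial queue lengths are independent. -/
structure IsInput {L : ℕ} {Ω : Type u} [MeasurableSpace Ω] (μ : Measure Ω) (r : Fin L → ℝ)
    (Q₀ : Ω → Fin L → ℕ) (A : ℕ → Ω → Fin L → ℕ) (H : ℕ → Ω → Channel L) : Prop where
  measurable_init : Measurable Q₀
  measurable_arrival : ∀ t, Measurable (A t)
  measurable_channel : ∀ t, Measurable (H t)
  channel_law : ∀ t, μ.map (H t) =
    Measure.pi (fun _ : Fin L => Measure.pi (fun _ : Fin L => stdComplexGaussian))
  arrival_law : ∀ t, μ.map (A t) = μ.map (A 0)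
  arrival_integrable : ∀ ℓ, Integrable (fun ω => (A 0 ω ℓ : ℝ)) μ
  arrival_rate : ∀ ℓ, ∫ ω, (A 0 ω ℓ : ℝ) ∂μ = r ℓ
  arrival_zero : 0 < μ {ω | A 0 ω = 0}
  indep_slots : iIndepFun (fun t ω => (A t ω, H t ω)) μ
  indep_arrival_channel : ∀ t, IndepFun (A t) (H t) μ
  indep_init : IndepFun Q₀ (fun ω t => (A t ω, H t ω)) μ

/-- The policy stabilizes all queues at the arrival-rate vector `r`, whatever the law of the arrivals
(with mean `r`) and of the initial queue lengths. -/
def Stabilizes {L : ℕ} (P θ : ℝ) (π : Policy L) (r : Fin L → ℝ) : Prop :=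
  ∀ (Ω : Type u) [MeasurableSpace Ω] (μ : Measure Ω) [IsProbabilityMeasure μ]
    (Q₀ : Ω → Fin L → ℕ) (A : ℕ → Ω → Fin L → ℕ) (H : ℕ → Ω → Channel L),
    IsInput μ r Q₀ A H →
    ∀ ℓ, IsStable μ
      (fun t ω => queueLength P θ π (Q₀ ω) (fun s => A s ω) (fun s => H s ω) t ℓ)

end SDMA

end

/-!
For fixed initial queue lengths the queue lengths form a Markov chain on `ℕ^L`, with transition laws
`queueKernel`. The theorem follows from the convergence of the laws of this chain to a stationary
law, which rests on three facts.

*Success probability.* Given the channels of the other scheduled users, the received power of user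
`ℓ` is the squared norm of the projection of its channel vector on a subspace of dimension at least
`n = L - |v| + 1`. The coordinates of a `CN(0,1)` vector in an orthonormal family are again i.i.d.
`CN(0,1)` (`map_inner_orthonormal`), and the squared norm of `n` of them has the law `Gamma(n, 1)`
(`isotropicGaussian_le_norm_sq`). Hence each of the scheduled users `v` succeeds with probability at
least `d(|v|)` (`depRate_le_channelLaw`).

*Drift.* The arrivals have only a first moment, so that the usual quadratic Lyapunov function may
have an infinite drift. The Euclidean norm `‖q‖` of the queue lengths is used instead. Its change in a
slot is `⟨q, A - S⟩ / ‖q‖`, where `A` are the arrivals and `S` the successes, up to an error that is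
dominated by an integrable variable and vanishes as `‖q‖ → ∞`. The mean of the main term is at most
`(∑ q ℓ * r ℓ - d(|v|) vᵀ q) / ‖q‖` with `v = π q`; since `v` maximizes `d(|v|) vᵀ q`, this is
at most `∑ q ℓ * (r ℓ - r' ℓ) / ‖q‖ ≤ -δ` for `r'` in the stability region with `r ℓ + δ ≤ r' ℓ`
(`integral_queueNorm_le`).

*Convergence.* The state `0` is accessible from all states, because without arrivals a scheduled
nonempty queue loses a packet with positive probability, and it is aperiodic, because there may be
no arrivals. The drift condition therefore makes the mean return time to `0` finite
(`exists_limit_law_of_foster`), the renewal theorem (`tendsto_renewal`) gives the convergence of the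
probability of the state `0`, and the decomposition according to the last visit of `0`
(`step_iterate_eq_last_exit`) carries it over to all events (`exists_limit_law`). The limit does not
depend on the initial state, so that the initial law plays no role.

The second claim follows from the first, because a vector of the stability region is a limit of
vectors that are strictly smaller than some vector of the region.
-/

open scoped ENNReal

namespace SDMA

/-! ### Renewal sequences -/

/-- Tannery's theorem for convolutions: if the shifted sequences `n ↦ b (n - k)` converge along a
filter that tends to infinity, so does the convolution of `b` with a summable sequence. -/
lemma tendsto_sum_mul_shift {a b w : ℕ → ℝ} {C : ℝ} (ha : Summable fun k => |a k|)
    (hb : ∀ n, |b n| ≤ C) {l : Filter ℕ} (hl : l ≤ atTop)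
    (hw : ∀ k, Tendsto (fun n => b (n - k)) l (𝓝 (w k))) :
    Tendsto (fun n => ∑ k ∈ Finset.range (n + 1), a k * b (n - k)) l (𝓝 (∑' k, a k * w k)) := by
  have hsum : ∀ n : ℕ, ∑ k ∈ Finset.range (n + 1), a k * b (n - k)
      = ∑' k, if k ≤ n then a k * b (n - k) else 0 := by
    intro n
    rw [tsum_eq_sum (s := Finset.range (n + 1))]
    · refine Finset.sum_congr rfl fun k hk => ?_
      rw [if_pos (by simpa [Nat.lt_succ_iff] using hk)]
    · intro k hk
      rw [if_neg (by simpa [Nat.lt_succ_iff] using hk)]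
  simp_rw [hsum]
  refine tendsto_tsum_of_dominated_convergence (bound := fun k => |a k| * C)
    (ha.mul_right C) (fun k => ?_) (Eventually.of_forall fun n k => ?_)
  · refine ((hw k).const_mul (a k)).congr' ?_
    filter_upwards [hl (eventually_ge_atTop k)] with n hn
    rw [if_pos hn]
  · split_ifs
    · rw [Real.norm_eq_abs, abs_mul]
      exact mul_le_mul_of_nonneg_left (hb _) (abs_nonneg _)
    · rw [norm_zero]
      exact mul_nonneg (abs_nonneg _) ((abs_nonneg _).trans (hb 0))

/-- The largest cluster point `c` of a bounded solution of the renewal equation is attained along an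
ultrafilter along which all shifts of the sequence converge to `c` as well: the limit of the shifts
is a solution of the renewal equation on the whole line that takes its maximum. -/
lemma exists_ultrafilter_tendsto_shift {F s : ℕ → ℝ} (hF : ∀ k, 0 ≤ F k) (hF0 : 0 < F 0)
    (hF1 : HasSum F 1) (hs : ∀ n, |s n| ≤ 1)
    (hren : ∀ n, s (n + 1) = ∑ k ∈ Finset.range (n + 1), F k * s (n - k)) :
    ∃ c : ℝ, (∀ d, MapClusterPt d atTop s → d ≤ c) ∧
      ∃ 𝒰 : Ultrafilter ℕ, (𝒰 : Filter ℕ) ≤ atTop ∧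
        ∀ k, Tendsto (fun n => s (n - k)) 𝒰 (𝓝 c) := by
  have hmem : ∀ n, s n ∈ Set.Icc (-1 : ℝ) 1 := fun n => abs_le.1 (hs n)
  have hclosed : IsClosed {d | MapClusterPt d atTop s} := isClosed_setOfPred_clusterPt
  have hsub : {d | MapClusterPt d atTop s} ⊆ Set.Icc (-1 : ℝ) 1 := fun d hd =>
    isClosed_Icc.mem_of_mapClusterPt hd (Eventually.of_forall hmem)
  have hne : {d | MapClusterPt d atTop s}.Nonempty := by
    obtain ⟨d, -, hd⟩ := isCompact_Icc.exists_mapClusterPt (f := atTop) (u := s)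
      (le_principal_iff.2 (mem_map.2 (Filter.univ_mem' hmem)))
    exact ⟨d, hd⟩
  obtain ⟨c, hc, hcmax⟩ := (isCompact_Icc.of_isClosed_subset hclosed hsub).exists_isGreatest hne
  refine ⟨c, fun d hd => hcmax hd, ?_⟩
  obtain ⟨𝒰, h𝒰, hc𝒰⟩ := mapClusterPt_iff_ultrafilter.1 hc
  refine ⟨𝒰, h𝒰, ?_⟩
  have hshift : ∀ k : ℕ, Tendsto (fun n : ℕ => n - k) (𝒰 : Filter ℕ) atTop := fun k =>
    (tendsto_sub_atTop_nat k).mono_left h𝒰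
  have hlim : ∀ k, ∃ w, Tendsto (fun n => s (n - k)) (𝒰 : Filter ℕ) (𝓝 w) := fun k => by
    obtain ⟨w, -, hw⟩ := (isCompact_Icc (a := (-1 : ℝ)) (b := 1)).ultrafilter_le_nhds'
      (𝒰.map fun n => s (n - k)) (by
        rw [Ultrafilter.mem_map]
        exact Filter.univ_mem' fun n => hmem _)
    exact ⟨w, hw⟩
  choose w hw using hlim
  have hwc : ∀ k, w k ≤ c := fun k => hcmax <| by
    have h1 : MapClusterPt (w k) (𝒰 : Filter ℕ) (fun n => s (n - k)) := (hw k).mapClusterPt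
    have h2 : map s (map (fun n => n - k) (𝒰 : Filter ℕ)) ≤ map s atTop := map_mono (hshift k)
    exact ClusterPt.mono h1 h2
  have hrec : ∀ k, w k = ∑' j, F j * w (k + 1 + j) := by
    intro k
    have hlim : Tendsto (fun n => ∑ j ∈ Finset.range (n + 1), F j * s (n - j))
        (map (fun n => n - (k + 1)) (𝒰 : Filter ℕ)) (𝓝 (∑' j, F j * w (k + 1 + j))) := by
      refine tendsto_sum_mul_shift (C := 1) (by simpa [abs_of_nonneg (hF _)] using hF1.summable)
        hs (hshift (k + 1)) fun j => ?_
      rw [tendsto_map'_iff]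
      refine (hw (k + 1 + j)).congr fun n => ?_
      simp only [Function.comp]
      congr 1
      omega
    rw [tendsto_map'_iff] at hlim
    refine tendsto_nhds_unique (hw k) (hlim.congr' ?_)
    filter_upwards [h𝒰 (eventually_ge_atTop (k + 1))] with n hn
    simp only [Function.comp]
    rw [← hren]
    congr 1
    omega
  have hall : ∀ k, w k = c := by
    intro k
    induction k with
    | zero => exact tendsto_nhds_unique (by simpa using hw 0) hc𝒰
    | succ k ih =>
      refine le_antisymm (hwc _) ?_
      -- A strict inequality at `k + 1` would make the average `w k = c` smaller than `c`.
      by_contra! hlt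
      have hsumF : Summable fun j => F j * w (k + 1 + j) := by
        refine Summable.of_norm_bounded (g := fun j => F j * 1) (by simpa using hF1.summable)
          fun j => ?_
        rw [Real.norm_eq_abs, abs_mul, abs_of_nonneg (hF j)]
        refine mul_le_mul_of_nonneg_left ?_ (hF j)
        exact le_of_tendsto (hw _).abs (Eventually.of_forall fun n => hs _)
      have hltsum : ∑' j, F j * w (k + 1 + j) < ∑' j, F j * c := by
        refine hsumF.tsum_lt_tsum (i := 0) (fun j => ?_) ?_ (hF1.summable.mul_right c)
        · exact mul_le_mul_of_nonneg_left (hwc _) (hF j)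
        · exact mul_lt_mul_of_pos_left (by simpa using hlt) hF0
      rw [← hrec, ih, tsum_mul_right, hF1.tsum_eq, one_mul] at hltsum
      exact lt_irrefl _ hltsum
  intro k
  rw [← hall k]
  exact hw k

/-- The renewal theorem (Erdős, Feller, Pollard) for a lifetime law `F` that charges `1` (`F k` is
the probability of the lifetime `k + 1`) and whose tail sequence `r` is summable. -/
theorem tendsto_renewal {F r u : ℕ → ℝ} (hF : ∀ k, 0 ≤ F k) (hF0 : 0 < F 0) (hF1 : HasSum F 1)
    (hr : ∀ k, 0 ≤ r k) (hrs : Summable r) (hu : ∀ n, |u n| ≤ 1)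
    (hren : ∀ n, u (n + 1) = ∑ k ∈ Finset.range (n + 1), F k * u (n - k))
    (htail : ∀ n, ∑ k ∈ Finset.range (n + 1), r k * u (n - k) = 1) :
    Tendsto u atTop (𝓝 (∑' k, r k)⁻¹) := by
  have key : ∀ (c : ℝ) (𝒰 : Ultrafilter ℕ), (𝒰 : Filter ℕ) ≤ atTop →
      (∀ k, Tendsto (fun n => u (n - k)) 𝒰 (𝓝 c)) → c = (∑' k, r k)⁻¹ := by
    intro c 𝒰 h𝒰 hc
    have h := tendsto_sum_mul_shift (a := r) (b := u) (w := fun _ => c) (C := 1)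
      (by simpa [abs_of_nonneg (hr _)] using hrs) hu h𝒰 hc
    simp_rw [htail] at h
    have h1 := tendsto_nhds_unique h tendsto_const_nhds
    rw [tsum_mul_right] at h1
    exact eq_inv_of_mul_eq_one_right h1
  obtain ⟨c, hcmax, 𝒰, h𝒰, hc⟩ := exists_ultrafilter_tendsto_shift hF hF0 hF1 hu hren
  obtain ⟨c', hcmax', 𝒱, h𝒱, hc'⟩ := exists_ultrafilter_tendsto_shift (s := fun n => -u n) hF hF0
    hF1 (by simpa using hu) (fun n => by simp [hren n])
  have e1 := key c 𝒰 h𝒰 hc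
  have e2 := key (-c') 𝒱 h𝒱 fun k => by simpa using (hc' k).neg
  refine isCompact_Icc.tendsto_nhds_of_unique_mapClusterPt (s := Set.Icc (-1 : ℝ) 1)
    (Eventually.of_forall fun n => abs_le.1 (hu n)) fun d _ hd => ?_
  refine le_antisymm (e1 ▸ hcmax d hd) ?_
  have := hcmax' (-d) (hd.continuousAt_comp continuous_neg.continuousAt)
  linarith

/-! ### Countable Markov chains with a regeneration state -/

section Chain

variable {S : Type*} [MeasurableSpace S]

/-- The transition operator `f ↦ (x ↦ E_x f(X₁))` of the Markov chain with transition laws `κ`. -/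
noncomputable def step (κ : S → Measure S) (f : S → ℝ≥0∞) (x : S) : ℝ≥0∞ := ∫⁻ y, f y ∂κ x

/-- The transition operator of the chain that is killed when it enters the state `o`. -/
noncomputable def tabooStep (κ : S → Measure S) (o : S) (f : S → ℝ≥0∞) (x : S) : ℝ≥0∞ :=
  ∫⁻ y, ({o}ᶜ : Set S).indicator f y ∂κ x

/-- The indicator function of the state `o`. -/
noncomputable def atom (o : S) : S → ℝ≥0∞ := ({o} : Set S).indicator 1

variable {κ : S → Measure S} {o : S}

lemma step_mono {f g : S → ℝ≥0∞} (h : f ≤ g) : step κ f ≤ step κ g := fun _ => lintegral_mono h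

lemma tabooStep_mono {f g : S → ℝ≥0∞} (h : f ≤ g) : tabooStep κ o f ≤ tabooStep κ o g :=
  fun _ => lintegral_mono fun _ => Set.indicator_le_indicator (h _)

lemma step_iterate_one [∀ x, IsProbabilityMeasure (κ x)] (t : ℕ) : (step κ)^[t] 1 = 1 := by
  induction t with
  | zero => rfl
  | succ t ih =>
    have : step κ 1 = 1 := by ext x; simp [step]
    rw [Function.iterate_succ_apply, this, ih]

lemma step_iterate_mono {f g : S → ℝ≥0∞} (h : f ≤ g) (t : ℕ) :
    (step κ)^[t] f ≤ (step κ)^[t] g :=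
  Monotone.iterate (f := step κ) (fun _ _ => step_mono) t h

lemma tabooStep_iterate_mono {f g : S → ℝ≥0∞} (h : f ≤ g) (t : ℕ) :
    (tabooStep κ o)^[t] f ≤ (tabooStep κ o)^[t] g :=
  Monotone.iterate (f := tabooStep κ o) (fun _ _ => tabooStep_mono) t h

lemma step_iterate_le_one [∀ x, IsProbabilityMeasure (κ x)] {f : S → ℝ≥0∞} (h : f ≤ 1) (t : ℕ)
    (x : S) : (step κ)^[t] f x ≤ 1 := by
  simpa [step_iterate_one] using step_iterate_mono (κ := κ) h t x

variable [DiscreteMeasurableSpace S]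

lemma step_add (f g : S → ℝ≥0∞) : step κ (f + g) = step κ f + step κ g := by
  ext x
  simp only [step, Pi.add_apply]
  exact lintegral_add_left .of_discrete _

lemma step_const_smul (c : ℝ≥0∞) (f : S → ℝ≥0∞) : step κ (c • f) = c • step κ f := by
  ext x
  simp only [step, Pi.smul_apply, smul_eq_mul]
  exact lintegral_const_mul _ .of_discrete

lemma tabooStep_add (f g : S → ℝ≥0∞) :
    tabooStep κ o (f + g) = tabooStep κ o f + tabooStep κ o g := by
  ext x
  simp only [tabooStep, Pi.add_apply, Set.indicator_add']
  exact lintegral_add_left .of_discrete _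

lemma tabooStep_const_smul (c : ℝ≥0∞) (f : S → ℝ≥0∞) :
    tabooStep κ o (c • f) = c • tabooStep κ o f := by
  ext x
  simp only [tabooStep, Pi.smul_apply, smul_eq_mul]
  rw [← lintegral_const_mul _ (Measurable.of_discrete (f := ({o}ᶜ : Set S).indicator f))]
  refine lintegral_congr fun y => ?_
  by_cases hy : y = o <;> simp [hy]

lemma step_sum {ι : Type*} (s : Finset ι) (f : ι → S → ℝ≥0∞) :
    step κ (∑ i ∈ s, f i) = ∑ i ∈ s, step κ (f i) := by
  induction s using Finset.cons_induction with
  | empty => ext x; simp [step]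
  | cons i s hi ih => rw [Finset.sum_cons, Finset.sum_cons, step_add, ih]

lemma tabooStep_sum {ι : Type*} (s : Finset ι) (f : ι → S → ℝ≥0∞) :
    tabooStep κ o (∑ i ∈ s, f i) = ∑ i ∈ s, tabooStep κ o (f i) := by
  induction s using Finset.cons_induction with
  | empty => ext x; simp [tabooStep]
  | cons i s hi ih => rw [Finset.sum_cons, Finset.sum_cons, tabooStep_add, ih]

lemma step_iterate_add (f g : S → ℝ≥0∞) (t : ℕ) :
    (step κ)^[t] (f + g) = (step κ)^[t] f + (step κ)^[t] g := by
  induction t generalizing f g with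
  | zero => rfl
  | succ t ih => simp only [Function.iterate_succ_apply, step_add, ih]

lemma step_iterate_const_smul (c : ℝ≥0∞) (f : S → ℝ≥0∞) (t : ℕ) :
    (step κ)^[t] (c • f) = c • (step κ)^[t] f := by
  induction t generalizing f with
  | zero => rfl
  | succ t ih => simp only [Function.iterate_succ_apply, step_const_smul, ih]

/-- One step either avoids `o` or enters it. -/
lemma step_eq_tabooStep_add (f : S → ℝ≥0∞) :
    step κ f = tabooStep κ o f + f o • step κ (atom o) := by
  ext x
  simp only [step, tabooStep, Pi.add_apply, Pi.smul_apply, smul_eq_mul]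
  rw [← lintegral_const_mul _ .of_discrete, ← lintegral_add_left .of_discrete]
  refine lintegral_congr fun y => ?_
  by_cases hy : y = o <;> simp [atom, hy]

/-- Decomposition according to the last visit of `o`. -/
lemma step_iterate_eq_last_exit (f : S → ℝ≥0∞) (t : ℕ) (x : S) :
    (step κ)^[t] f x = (tabooStep κ o)^[t] f x +
      ∑ k ∈ Finset.range t, (tabooStep κ o)^[k] f o * (step κ)^[t - k] (atom o) x := by
  induction t generalizing f with
  | zero => simp
  | succ t ih =>
    rw [Function.iterate_succ_apply, step_eq_tabooStep_add (o := o) f, step_iterate_add,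
      step_iterate_const_smul, Pi.add_apply, ih, Finset.sum_range_succ', add_assoc]
    simp

/-- Decomposition according to the first visit of `o` after time `0`. -/
lemma step_iterate_eq_first_entrance (f : S → ℝ≥0∞) (t : ℕ) :
    (step κ)^[t] f = (tabooStep κ o)^[t] f + ∑ k ∈ Finset.range t,
      (step κ)^[t - 1 - k] f o • (tabooStep κ o)^[k] (step κ (atom o)) := by
  induction t with
  | zero => simp
  | succ t ih =>
    rw [Function.iterate_succ_apply', step_eq_tabooStep_add (o := o), Finset.sum_range_succ']
    nth_rewrite 1 [ih]
    rw [tabooStep_add, tabooStep_sum]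
    simp only [tabooStep_const_smul, ← Function.iterate_succ_apply' (f := tabooStep κ o)]
    simp only [add_assoc, Nat.add_sub_cancel, Nat.sub_zero, Function.iterate_zero, id]
    congr 2
    refine Finset.sum_congr rfl fun k _ => ?_
    rw [show t - 1 - k = t - (k + 1) by omega]

/-- A drift condition bounds the expected number of steps before `o` is entered. -/
lemma sum_tabooStep_le_of_drift {W : S → ℝ≥0∞} {ε : ℝ≥0∞}
    (hdrift : ∀ x ≠ o, step κ W x + ε ≤ W x) (n : ℕ) {x : S} (hx : x ≠ o) :
    ∑ k ∈ Finset.range n, ε * (tabooStep κ o)^[k] 1 x ≤ W x := by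
  suffices h : ∀ n x, x ≠ o →
      (∑ k ∈ Finset.range n, ε • (tabooStep κ o)^[k] 1) x ≤ W x by
    simpa using h n x hx
  intro n
  induction n with
  | zero => simp
  | succ n ih =>
    intro x hx
    refine le_trans ?_ (hdrift x hx)
    rw [Finset.sum_range_succ', Pi.add_apply]
    refine add_le_add ?_ (by simp)
    have : ∑ k ∈ Finset.range n, ε • (tabooStep κ o)^[k + 1] 1
        = tabooStep κ o (∑ k ∈ Finset.range n, ε • (tabooStep κ o)^[k] 1) := by
      rw [tabooStep_sum]
      simp only [tabooStep_const_smul, ← Function.iterate_succ_apply' (f := tabooStep κ o)]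
    rw [this]
    refine lintegral_mono fun y => ?_
    by_cases hy : y = o
    · simp [hy]
    · simpa [hy] using ih y hy

/-- Under the drift condition the first visit of `o` after time `0` has a finite mean. -/
lemma tsum_tabooStep_ne_top [∀ x, IsProbabilityMeasure (κ x)] {W : S → ℝ≥0∞} {ε : ℝ≥0∞}
    (hε : ε ≠ 0) (hW : ∀ x, W x ≠ ∞) (hWo : step κ W o ≠ ∞)
    (hdrift : ∀ x ≠ o, step κ W x + ε ≤ W x) (x : S) :
    ∑' k, (tabooStep κ o)^[k] 1 x ≠ ∞ := by
  have hne : ∀ x ≠ o, ε * ∑' k, (tabooStep κ o)^[k] 1 x ≤ W x := by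
    intro x hx
    rw [← ENNReal.tsum_mul_left, ENNReal.tsum_eq_iSup_nat]
    exact iSup_le fun n => sum_tabooStep_le_of_drift hdrift n hx
  have hfin : ∀ a b : ℝ≥0∞, ε * a ≤ b → b ≠ ∞ → a ≠ ∞ := by
    rintro a b hab hb rfl
    rw [ENNReal.mul_top hε] at hab
    exact hb (top_le_iff.1 hab)
  by_cases hx : x = o
  · subst hx
    rw [tsum_eq_zero_add' ENNReal.summable]
    refine ENNReal.add_ne_top.2 ⟨by simp, hfin _ (step κ W x) ?_ hWo⟩
    simp only [Function.iterate_succ_apply', tabooStep]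
    rw [← lintegral_tsum fun _ => .of_discrete, ← lintegral_const_mul _ .of_discrete]
    refine lintegral_mono fun y => ?_
    by_cases hy : y = x
    · simp [hy]
    · simpa [hy] using hne y hy
  · exact hfin _ _ (hne x hx) (hW x)

variable (κ o) in
/-- The occupation law of the killed chain at time `k`, for a start in `o`. -/
noncomputable def tabooLaw : ℕ → Measure S
  | 0 => Measure.dirac o
  | k + 1 => ((tabooLaw k).bind κ).restrict {o}ᶜ

lemma lintegral_tabooLaw [Countable S] (f : S → ℝ≥0∞) (k : ℕ) :
    ∫⁻ y, f y ∂tabooLaw κ o k = (tabooStep κ o)^[k] f o := by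
  induction k generalizing f with
  | zero => simp [tabooLaw, lintegral_dirac' _ (Measurable.of_discrete (f := f))]
  | succ k ih =>
    rw [tabooLaw, ← lintegral_indicator .of_discrete,
      Measure.lintegral_bind (measurable_of_countable _).aemeasurable
        Measurable.of_discrete.aemeasurable, Function.iterate_succ_apply, ← ih]
    rfl

/-- The probability of a visit of the aperiodic positive recurrent state `o` at time `t` converges,
for every initial state, to the inverse of the mean return time. -/
lemma tendsto_step_iterate_atom [∀ x, IsProbabilityMeasure (κ x)] (ho : κ o {o} ≠ 0)
    (hfin : ∀ x, ∑' k, (tabooStep κ o)^[k] 1 x ≠ ∞) (x : S) :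
    Tendsto (fun t => ((step κ)^[t] (atom o) x).toReal) atTop
      (𝓝 (∑' k, ((tabooStep κ o)^[k] 1 o).toReal)⁻¹) := by
  set e : S → ℝ≥0∞ := step κ (atom o) with he
  have hatom : atom o ≤ 1 := Set.indicator_le_self' fun _ _ => zero_le
  have he1 : e ≤ 1 := fun y => step_iterate_le_one (κ := κ) hatom 1 y
  have hu1 : ∀ t y, (step κ)^[t] (atom o) y ≤ 1 := step_iterate_le_one hatom
  have huT : ∀ t y, (step κ)^[t] (atom o) y ≠ ∞ := fun t y =>
    ne_top_of_le_ne_top ENNReal.one_ne_top (hu1 t y)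
  have hrT : ∀ y k, (tabooStep κ o)^[k] 1 y ≠ ∞ := fun y k =>
    ENNReal.ne_top_of_tsum_ne_top (hfin y) k
  have hFle : ∀ y k, (tabooStep κ o)^[k] e y ≤ (tabooStep κ o)^[k] 1 y := fun y k =>
    tabooStep_iterate_mono he1 k y
  have hFT : ∀ y k, (tabooStep κ o)^[k] e y ≠ ∞ := fun y k =>
    ne_top_of_le_ne_top (hrT y k) (hFle y k)
  -- The killed chain started from `atom o` dies at once, so that only visits of `o` contribute.
  have hkill : ∀ t, (tabooStep κ o)^[t + 1] (atom o) = 0 := by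
    intro t
    have h0 : tabooStep κ o (atom o) = 0 := by
      ext y
      simp [tabooStep, atom, Set.indicator_indicator]
    have h1 : ∀ t, (tabooStep κ o)^[t] 0 = 0 := fun t => by
      induction t with
      | zero => rfl
      | succ t ih =>
        rw [Function.iterate_succ_apply', ih]
        ext y
        simp [tabooStep]
    rw [Function.iterate_succ_apply, h0, h1]
  have hren : ∀ y t, (step κ)^[t + 1] (atom o) y = ∑ k ∈ Finset.range (t + 1),
      (tabooStep κ o)^[k] e y * (step κ)^[t - k] (atom o) o := by
    intro y t
    rw [step_iterate_eq_first_entrance (o := o), hkill]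
    simp [Finset.sum_apply, mul_comm, he]
  have hrenR : ∀ y t, ((step κ)^[t + 1] (atom o) y).toReal = ∑ k ∈ Finset.range (t + 1),
      ((tabooStep κ o)^[k] e y).toReal * ((step κ)^[t - k] (atom o) o).toReal := by
    intro y t
    rw [hren, ENNReal.toReal_sum fun k _ => ENNReal.mul_ne_top (hFT y k) (huT _ _)]
    simp_rw [ENNReal.toReal_mul]
  have hr0 : ∀ y, Tendsto (fun t => (tabooStep κ o)^[t] 1 y) atTop (𝓝 0) := fun y =>
    ENNReal.tendsto_atTop_zero_of_tsum_ne_top (hfin y)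
  have hFsum : ∀ y, HasSum (fun k => ((tabooStep κ o)^[k] e y).toReal) 1 := by
    intro y
    have htot : ∀ t, 1 = (tabooStep κ o)^[t] 1 y +
        ∑ k ∈ Finset.range t, (tabooStep κ o)^[k] e y := by
      intro t
      have := congrFun (step_iterate_eq_first_entrance (κ := κ) (o := o) 1 t) y
      simpa [step_iterate_one, Finset.sum_apply] using this
    rw [hasSum_iff_tendsto_nat_of_nonneg fun k => ENNReal.toReal_nonneg]
    have h1 : ∀ t, ∑ k ∈ Finset.range t, ((tabooStep κ o)^[k] e y).toReal
        = 1 - ((tabooStep κ o)^[t] 1 y).toReal := by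
      intro t
      have := congrArg ENNReal.toReal (htot t)
      rw [ENNReal.toReal_add (hrT y t) (ENNReal.sum_ne_top.2 fun k _ => hFT y k),
        ENNReal.toReal_sum fun k _ => hFT y k, ENNReal.toReal_one] at this
      linarith
    simp_rw [h1]
    have h2 := (ENNReal.tendsto_toReal ENNReal.zero_ne_top).comp (hr0 y)
    simpa using h2.const_sub 1
  have huo : Tendsto (fun t => ((step κ)^[t] (atom o) o).toReal) atTop
      (𝓝 (∑' k, ((tabooStep κ o)^[k] 1 o).toReal)⁻¹) := by
    refine tendsto_renewal (F := fun k => ((tabooStep κ o)^[k] e o).toReal)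
      (fun k => ENNReal.toReal_nonneg) ?_ (hFsum o) (fun k => ENNReal.toReal_nonneg)
      (ENNReal.summable_toReal (hfin o)) (fun n => ?_) (hrenR o) fun n => ?_
    · refine ENNReal.toReal_pos ?_ (hFT o 0)
      have : step κ (atom o) o = κ o {o} := by
        rw [step, atom, lintegral_indicator_one .of_discrete]
      simpa [he, this] using ho
    · rw [abs_of_nonneg ENNReal.toReal_nonneg]
      simpa using ENNReal.toReal_mono ENNReal.one_ne_top (hu1 n o)
    · have h := step_iterate_eq_last_exit (κ := κ) (o := o) 1 n o
      have hlast : (tabooStep κ o)^[n] 1 o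
          = (tabooStep κ o)^[n] 1 o * (step κ)^[n - n] (atom o) o := by simp [atom]
      rw [hlast, add_comm, ← Finset.sum_range_succ
        (f := fun k => (tabooStep κ o)^[k] 1 o * (step κ)^[n - k] (atom o) o),
        step_iterate_one] at h
      have h' := congrArg ENNReal.toReal h
      rw [ENNReal.toReal_sum fun k _ => ENNReal.mul_ne_top (hrT o k) (huT _ _)] at h'
      simpa [ENNReal.toReal_mul] using h'.symm
  rw [← tendsto_add_atTop_iff_nat 1]
  simp_rw [hrenR x]
  have := tendsto_sum_mul_shift (a := fun k => ((tabooStep κ o)^[k] e x).toReal)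
    (b := fun t => ((step κ)^[t] (atom o) o).toReal) (C := 1)
    (w := fun _ => (∑' k, ((tabooStep κ o)^[k] 1 o).toReal)⁻¹)
    (by simpa using (hFsum x).summable)
    (fun n => by
      rw [abs_of_nonneg ENNReal.toReal_nonneg]
      simpa using ENNReal.toReal_mono ENNReal.one_ne_top (hu1 n o))
    (le_refl atTop) (fun k => huo.comp (tendsto_sub_atTop_nat k))
  rwa [tsum_mul_right, (hFsum x).tsum_eq, one_mul] at this

/-- Convergence to the stationary law: a countable chain with an aperiodic state `o` and a Lyapunov
function with negative drift off `o` has a limit law, the same for all initial states. -/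
theorem exists_limit_law [Countable S] [∀ x, IsProbabilityMeasure (κ x)] (ho : κ o {o} ≠ 0)
    {W : S → ℝ≥0∞} {ε : ℝ≥0∞} (hε : ε ≠ 0) (hW : ∀ x, W x ≠ ∞) (hWo : step κ W o ≠ ∞)
    (hdrift : ∀ x ≠ o, step κ W x + ε ≤ W x) :
    ∃ ν : Measure S, IsProbabilityMeasure ν ∧ ∀ (s : Set S) (x : S),
      Tendsto (fun t => ((step κ)^[t] (s.indicator 1) x).toReal) atTop (𝓝 (ν.real s)) := by
  have hfin := tsum_tabooStep_ne_top hε hW hWo hdrift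
  set m : ℝ≥0∞ := ∑' k, (tabooStep κ o)^[k] 1 o with hm
  have hm0 : m ≠ 0 := by
    have : (tabooStep κ o)^[0] 1 o ≤ m := ENNReal.le_tsum 0
    intro h
    simp [h] at this
  have hlaw : ∀ s : Set S, (m⁻¹ • Measure.sum (tabooLaw κ o)) s
      = m⁻¹ * ∑' k, (tabooStep κ o)^[k] (s.indicator 1) o := by
    intro s
    rw [Measure.smul_apply, smul_eq_mul, Measure.sum_apply _ .of_discrete]
    congr 1
    refine tsum_congr fun k => ?_
    rw [← lintegral_tabooLaw, lintegral_indicator_one .of_discrete]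
  refine ⟨m⁻¹ • Measure.sum (tabooLaw κ o), ⟨?_⟩, fun s x => ?_⟩
  · rw [hlaw, Set.indicator_univ, ENNReal.inv_mul_cancel hm0 (hfin o)]
  have hs : s.indicator (1 : S → ℝ≥0∞) ≤ 1 := Set.indicator_le_self' fun _ _ => zero_le
  have hle : ∀ y k, (tabooStep κ o)^[k] (s.indicator 1) y ≤ (tabooStep κ o)^[k] 1 y :=
    fun y k => tabooStep_iterate_mono hs k y
  have hT : ∀ y k, (tabooStep κ o)^[k] (s.indicator 1) y ≠ ∞ := fun y k =>
    ne_top_of_le_ne_top (ENNReal.ne_top_of_tsum_ne_top (hfin y) k) (hle y k)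
  have hatom : atom o ≤ 1 := Set.indicator_le_self' fun _ _ => zero_le
  have hu1 : ∀ t y, (step κ)^[t] (atom o) y ≤ 1 := step_iterate_le_one hatom
  have huT : ∀ t y, (step κ)^[t] (atom o) y ≠ ∞ := fun t y =>
    ne_top_of_le_ne_top ENNReal.one_ne_top (hu1 t y)
  have hsum : Summable fun k => ((tabooStep κ o)^[k] (s.indicator 1) o).toReal :=
    ENNReal.summable_toReal
      (ne_top_of_le_ne_top (hfin o) (ENNReal.tsum_le_tsum fun k => hle o k))
  have hlim := tendsto_sum_mul_shift (C := 1) (l := atTop)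
    (a := fun k => ((tabooStep κ o)^[k] (s.indicator 1) o).toReal)
    (b := fun t => ((step κ)^[t] (atom o) x).toReal)
    (w := fun _ => (∑' k, ((tabooStep κ o)^[k] 1 o).toReal)⁻¹) (by simpa using hsum)
    (fun n => by
      rw [abs_of_nonneg ENNReal.toReal_nonneg]
      simpa using ENNReal.toReal_mono ENNReal.one_ne_top (hu1 n x))
    le_rfl fun k => (tendsto_step_iterate_atom ho hfin x).comp (tendsto_sub_atTop_nat k)
  have hrest : Tendsto (fun t => ((tabooStep κ o)^[t] (s.indicator 1) x).toReal
      - ((tabooStep κ o)^[t] (s.indicator 1) o).toReal * ((step κ)^[t - t] (atom o) x).toReal)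
      atTop (𝓝 0) := by
    have h0 : ∀ y, Tendsto (fun t => ((tabooStep κ o)^[t] (s.indicator 1) y).toReal) atTop
        (𝓝 0) := by
      intro y
      have := tendsto_of_tendsto_of_tendsto_of_le_of_le tendsto_const_nhds
        (ENNReal.tendsto_atTop_zero_of_tsum_ne_top (hfin y)) (fun _ => zero_le) (hle y)
      simpa [Function.comp_def] using (ENNReal.tendsto_toReal ENNReal.zero_ne_top).comp this
    simpa using (h0 x).sub ((h0 o).mul_const ((step κ)^[0] (atom o) x).toReal)
  have hval : (m⁻¹ • Measure.sum (tabooLaw κ o)).real s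
      = 0 + ∑' k, ((tabooStep κ o)^[k] (s.indicator 1) o).toReal
        * (∑' k, ((tabooStep κ o)^[k] 1 o).toReal)⁻¹ := by
    rw [measureReal_def, hlaw, ENNReal.toReal_mul, ENNReal.toReal_inv, hm,
      ENNReal.tsum_toReal_eq fun k => ENNReal.ne_top_of_tsum_ne_top (hfin o) k,
      ENNReal.tsum_toReal_eq (hT o), tsum_mul_right, zero_add, mul_comm]
  rw [hval]
  refine (hrest.add hlim).congr fun t => ?_
  rw [step_iterate_eq_last_exit (o := o) (s.indicator 1), ENNReal.toReal_add (hT x t)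
    (ENNReal.sum_ne_top.2 fun k _ => ENNReal.mul_ne_top (hT o k) (huT _ _)),
    ENNReal.toReal_sum fun k _ => ENNReal.mul_ne_top (hT o k) (huT _ _), Finset.sum_range_succ]
  simp_rw [ENNReal.toReal_mul]
  ring

end Chain

/-! ### Foster's criterion -/

section Foster

variable {S : Type*} [MeasurableSpace S] {κ : S → Measure S} {o : S}

variable (κ o) in
/-- The probability that `o` is not visited in the slots `0, …, n`. -/
noncomputable def survival (n : ℕ) : S → ℝ≥0∞ := ({o}ᶜ : Set S).indicator ((tabooStep κ o)^[n] 1)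

lemma survival_succ (n : ℕ) {x : S} (hx : x ≠ o) :
    survival κ o (n + 1) x = step κ (survival κ o n) x := by
  simp only [survival, Function.iterate_succ_apply']
  rw [Set.indicator_of_mem (by simpa using hx)]
  rfl

lemma survival_zero {x : S} (hx : x ≠ o) : survival κ o 0 x = 1 := by
  simp [survival, hx]

lemma survival_antitone [∀ x, IsProbabilityMeasure (κ x)] : Antitone (survival κ o) := by
  refine antitone_nat_of_succ_le fun n x => Set.indicator_le_indicator ?_
  rw [Function.iterate_succ_apply]
  refine tabooStep_iterate_mono (fun y => ?_) n x
  refine (lintegral_mono fun z => Set.indicator_le_self' (fun _ _ => zero_le) z).trans ?_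
  simp

lemma survival_le_one [∀ x, IsProbabilityMeasure (κ x)] (n : ℕ) (x : S) :
    survival κ o n x ≤ 1 :=
  (survival_antitone (Nat.zero_le n) x).trans (Set.indicator_le_self' (fun _ _ => zero_le) x)

variable [DiscreteMeasurableSpace S]

/-- If a potential can decrease in one step from each state other than `o`, then `o` is accessible
from all states. -/
lemma exists_survival_lt_one [Countable S] [∀ x, IsProbabilityMeasure (κ x)] {φ : S → ℕ}
    (hφ : ∀ x ≠ o, κ x {y | φ y < φ x} ≠ 0) (x : S) : ∃ n, survival κ o n x < 1 := by
  induction hk : φ x using Nat.strong_induction_on generalizing x with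
  | _ k ih =>
  by_cases hx : x = o
  · exact ⟨0, by simp [survival, hx]⟩
  have hy : ∃ y, φ y < φ x ∧ κ x {y} ≠ 0 := by
    by_contra! h
    refine hφ x hx ?_
    rw [← Set.biUnion_of_singleton {y | φ y < φ x}]
    exact (measure_biUnion_null_iff (Set.to_countable _)).2 h
  obtain ⟨y, hyx, hκy⟩ := hy
  obtain ⟨n, hn⟩ := ih (φ y) (hk ▸ hyx) y rfl
  refine ⟨n + 1, ?_⟩
  rw [survival_succ n hx]
  have hle : step κ (survival κ o n) x + (1 - survival κ o n y) * κ x {y} ≤ 1 := by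
    rw [step, ← lintegral_indicator_const .of_discrete, ← lintegral_add_left .of_discrete]
    refine (lintegral_mono (g := fun _ => 1) fun z => ?_).trans (by simp)
    by_cases hz : z = y
    · subst hz
      simp [add_tsub_cancel_of_le hn.le]
    · simpa [hz] using survival_le_one n z
  refine lt_of_lt_of_le (ENNReal.lt_add_right ?_ ?_) hle
  · exact ne_top_of_le_ne_top ENNReal.one_ne_top (le_self_add.trans hle)
  · exact mul_ne_zero (tsub_pos_of_lt hn).ne' hκy

/-- Convergence to the stationary law under Foster's criterion. A Lyapunov function with negative
drift off a finite set suffices: a multiple of the expected number of the first `N` slots before the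
visit of `o` is added to it, which makes the drift negative also on the finite set. -/
theorem exists_limit_law_of_foster [Countable S] [∀ x, IsProbabilityMeasure (κ x)]
    (ho : κ o {o} ≠ 0) {φ : S → ℕ} (hφ : ∀ x ≠ o, κ x {y | φ y < φ x} ≠ 0)
    {V : S → ℝ≥0∞} {ε b : ℝ≥0∞} (hε : ε ≠ 0) (hε' : ε ≠ ∞) (hb : b ≠ ∞) (hV : ∀ x, V x ≠ ∞)
    {C : Set S} (hC : C.Finite) (hdrift : ∀ x ∉ C, step κ V x + ε ≤ V x)
    (hbound : ∀ x, step κ V x ≤ V x + b) :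
    ∃ ν : Measure S, IsProbabilityMeasure ν ∧ ∀ (s : Set S) (x : S),
      Tendsto (fun t => ((step κ)^[t] (s.indicator 1) x).toReal) atTop (𝓝 (ν.real s)) := by
  choose n hn using exists_survival_lt_one (κ := κ) (o := o) hφ
  set N := hC.toFinset.sup n with hN
  have hlt : ∀ x ∈ C, survival κ o N x < 1 := fun x hx =>
    (survival_antitone (Finset.le_sup (hC.mem_toFinset.2 hx)) x).trans_lt (hn x)
  set δ : ℝ≥0∞ := hC.toFinset.inf fun x => 1 - survival κ o N x with hδ
  have hδ0 : δ ≠ 0 := by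
    refine ne_of_gt ((Finset.lt_inf_iff ENNReal.zero_lt_top).2 fun x hx => ?_)
    exact tsub_pos_of_lt (hlt x (hC.mem_toFinset.1 hx))
  have hδC : ∀ x ∈ C, δ ≤ 1 - survival κ o N x := fun x hx =>
    Finset.inf_le (hC.mem_toFinset.2 hx)
  set H : S → ℝ≥0∞ := ∑ k ∈ Finset.range N, survival κ o k with hH
  have hHN : ∀ x, H x ≤ N := fun x => by
    rw [hH, Finset.sum_apply]
    exact (Finset.sum_le_sum fun k _ => survival_le_one k x).trans (by simp)
  have hHstep : ∀ x ≠ o, step κ H x + 1 = H x + survival κ o N x := by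
    intro x hx
    have h1 : step κ H x = ∑ k ∈ Finset.range N, survival κ o (k + 1) x := by
      rw [hH, step_sum, Finset.sum_apply]
      exact Finset.sum_congr rfl fun k _ => (survival_succ k hx).symm
    rw [h1, ← survival_zero (κ := κ) hx,
      ← Finset.sum_range_succ' (f := fun k => survival κ o k x), Finset.sum_range_succ, hH,
      Finset.sum_apply]
  have hST : ∀ x, survival κ o N x ≠ ∞ := fun x =>
    ne_top_of_le_ne_top ENNReal.one_ne_top (survival_le_one N x)
  have hHle : ∀ x ≠ o, step κ H x ≤ H x := by
    intro x hx
    refine (ENNReal.add_le_add_iff_right ENNReal.one_ne_top).1 ?_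
    rw [hHstep x hx]
    gcongr
    exact survival_le_one N x
  have hHC : ∀ x ∈ C, x ≠ o → step κ H x + δ ≤ H x := by
    intro x hxC hx
    refine (ENNReal.add_le_add_iff_right (hST x)).1 ?_
    rw [← hHstep x hx, add_assoc]
    gcongr
    calc δ + survival κ o N x ≤ (1 - survival κ o N x) + survival κ o N x := by
          gcongr; exact hδC x hxC
      _ = 1 := tsub_add_cancel_of_le (survival_le_one N x)
  set K : ℝ≥0∞ := (b + ε) / δ with hK
  have hKT : K ≠ ∞ := ENNReal.div_ne_top (ENNReal.add_ne_top.2 ⟨hb, hε'⟩) hδ0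
  have hstepW : ∀ x, step κ (V + K • H) x = step κ V x + K * step κ H x := fun x => by
    rw [step_add, step_const_smul]; rfl
  refine exists_limit_law (W := V + K • H) ho hε (fun x => ?_) ?_ fun x hx => ?_
  · exact ENNReal.add_ne_top.2 ⟨hV x, ENNReal.mul_ne_top hKT
      (ne_top_of_le_ne_top (ENNReal.natCast_ne_top N) (hHN x))⟩
  · rw [hstepW]
    refine ENNReal.add_ne_top.2 ⟨ne_top_of_le_ne_top (ENNReal.add_ne_top.2 ⟨hV o, hb⟩) (hbound o),
      ENNReal.mul_ne_top hKT (ne_top_of_le_ne_top (ENNReal.natCast_ne_top N) ?_)⟩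
    exact (lintegral_mono fun y => hHN y).trans (by simp)
  · rw [hstepW]
    change _ ≤ V x + K * H x
    by_cases hxC : x ∈ C
    · have hδT : δ ≠ ∞ := ne_top_of_le_ne_top ENNReal.one_ne_top
        ((hδC x hxC).trans tsub_le_self)
      calc step κ V x + K * step κ H x + ε ≤ V x + b + K * step κ H x + ε := by
            gcongr; exact hbound x
        _ = V x + (K * step κ H x + (b + ε)) := by ring
        _ = V x + K * (step κ H x + δ) := by
            rw [mul_add, hK, ENNReal.div_mul_cancel hδ0 hδT]
        _ ≤ V x + K * H x := by gcongr; exact hHC x hxC hx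
    · calc step κ V x + K * step κ H x + ε = (step κ V x + ε) + K * step κ H x := by ring
        _ ≤ V x + K * H x := by gcongr; exacts [hdrift x hxC, hHle x hx]

end Foster

/-! ### The squared norm of an isotropic Gaussian vector -/

section IsotropicGaussian

open Complex

variable (V : Type*) [NormedAddCommGroup V] [InnerProductSpace ℝ V] [FiniteDimensional ℝ V]
  [MeasurableSpace V] [BorelSpace V]

/-- The centred Gaussian law with density proportional to `exp (-‖x‖²)`; the real coordinates in an
orthonormal basis have variance `1/2`. -/
noncomputable def isotropicGaussian : Measure V :=
  volume.withDensity fun x =>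
    ENNReal.ofReal ((∫ y : V, Real.exp (-‖y‖ ^ 2))⁻¹ * Real.exp (-‖x‖ ^ 2))

lemma integral_exp_neg_norm_sq_pos : 0 < ∫ y : V, Real.exp (-‖y‖ ^ 2) := by
  have h := GaussianFourier.integral_rexp_neg_mul_sq_norm (V := V) one_pos
  simp only [neg_mul, one_mul, div_one] at h
  rw [h]
  positivity

lemma integrable_exp_neg_norm_sq : Integrable fun y : V => Real.exp (-‖y‖ ^ 2) := by
  by_contra h
  exact (integral_exp_neg_norm_sq_pos V).ne' (integral_undef h)

instance : IsProbabilityMeasure (isotropicGaussian V) := by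
  constructor
  rw [isotropicGaussian, withDensity_apply _ MeasurableSet.univ, Measure.restrict_univ,
    ← ofReal_integral_eq_lintegral_ofReal ((integrable_exp_neg_norm_sq V).const_mul _)
      (Eventually.of_forall fun x => by
        have := integral_exp_neg_norm_sq_pos V
        positivity), integral_const_mul,
    inv_mul_cancel₀ (integral_exp_neg_norm_sq_pos V).ne', ENNReal.ofReal_one]

variable {V}

lemma charFun_isotropicGaussian (t : V) :
    charFun (isotropicGaussian V) t = cexp (-(‖t‖ : ℂ) ^ 2 / 4) := by
  have h1 : (0 : ℝ) < (1 : ℂ).re := by simp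
  have h0 := GaussianFourier.integral_cexp_neg_mul_sq_norm (V := V) h1
  have ht := GaussianFourier.integral_cexp_neg_mul_sq_norm_add (V := V) h1 I t
  have hc : ((∫ y : V, Real.exp (-‖y‖ ^ 2) : ℝ) : ℂ) = ∫ y : V, cexp (-1 * (‖y‖ : ℂ) ^ 2) := by
    rw [← integral_complex_ofReal]
    refine integral_congr_ae (Eventually.of_forall fun y => ?_)
    push_cast
    simp
  have hc0 : ((∫ y : V, Real.exp (-‖y‖ ^ 2) : ℝ) : ℂ) ≠ 0 :=
    ofReal_ne_zero.2 (integral_exp_neg_norm_sq_pos V).ne'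
  rw [charFun_apply, isotropicGaussian, integral_withDensity_eq_integral_toReal_smul
    (by fun_prop) (by simp)]
  have hi : ∀ x : V, (ENNReal.ofReal ((∫ y : V, Real.exp (-‖y‖ ^ 2))⁻¹ *
      Real.exp (-‖x‖ ^ 2))).toReal • cexp ((inner ℝ x t : ℝ) * I)
      = ((∫ y : V, Real.exp (-‖y‖ ^ 2) : ℝ) : ℂ)⁻¹ *
        cexp (-1 * (‖x‖ : ℂ) ^ 2 + I * (inner ℝ t x : ℝ)) := by
    intro x
    have := integral_exp_neg_norm_sq_pos V
    rw [ENNReal.toReal_ofReal (by positivity), real_smul, real_inner_comm, exp_add]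
    push_cast
    rw [mul_comm I]
    ring_nf
  simp_rw [hi]
  rw [integral_const_mul, ht, ← h0, ← hc, inv_mul_cancel_left₀ hc0]
  congr 1
  rw [I_sq]
  ring

/-- The radial integral of `exp (-r²)` in dimension `2 n` is an incomplete gamma integral. -/
lemma integral_pow_mul_exp_neg_sq {n : ℕ} (hn : 1 ≤ n) {s : ℝ} (hs : 0 ≤ s) :
    ∫ y in Set.Ioi √s, y ^ (2 * n - 1) * Real.exp (-y ^ 2) = 2⁻¹ * upperGamma n s := by
  have h := integral_comp_rpow_Ioi_of_pos' (g := fun t : ℝ => t ^ ((n : ℝ) - 1) * Real.exp (-t))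
    (p := 2) two_pos hs
  rw [upperGamma, ← h, ← integral_const_mul, Real.sqrt_eq_rpow, ← one_div]
  refine setIntegral_congr_fun measurableSet_Ioi fun y hy => ?_
  have hy0 : 0 < y := lt_of_le_of_lt (Real.rpow_nonneg hs _) hy
  simp only [smul_eq_mul]
  rw [← Real.rpow_mul hy0.le, Real.rpow_two]
  have e : y ^ (2 * n - 1) = y ^ ((2 : ℝ) - 1) * y ^ (2 * ((n : ℝ) - 1)) := by
    rw [← Real.rpow_add hy0, ← Real.rpow_natCast]
    congr 1
    push_cast [show 1 ≤ 2 * n by omega]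
    ring
  rw [e]
  ring

/-- The squared norm of an isotropic Gaussian vector of even dimension `2 n` (coordinates of
variance `1/2`) has the law `Gamma(n, 1)`. -/
lemma isotropicGaussian_le_norm_sq {n : ℕ} (hn : 1 ≤ n) (hV : Module.finrank ℝ V = 2 * n) {s : ℝ}
    (hs : 0 ≤ s) :
    (isotropicGaussian V).real {x | s ≤ ‖x‖ ^ 2} = upperGamma n s / Real.Gamma n := by
  have : Nontrivial V := Module.nontrivial_of_finrank_pos (R := ℝ) (by omega)
  have hset : MeasurableSet {x : V | s ≤ ‖x‖ ^ 2} :=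
    measurableSet_le measurable_const (by fun_prop)
  have hpos := integral_exp_neg_norm_sq_pos V
  have hG : Real.Gamma n = upperGamma n 0 := by
    rw [Real.Gamma_eq_integral (by exact_mod_cast hn), upperGamma]
    simp_rw [mul_comm]
  have hrad : ∀ s : ℝ, 0 ≤ s → ∫ x in {x : V | s ≤ ‖x‖ ^ 2}, Real.exp (-‖x‖ ^ 2)
      = (2 * n : ℕ) • (volume : Measure V).real (Metric.ball 0 1) • (2⁻¹ * upperGamma n s) := by
    intro s hs
    have hset : MeasurableSet {x : V | s ≤ ‖x‖ ^ 2} :=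
      measurableSet_le measurable_const (by fun_prop)
    rw [← integral_pow_mul_exp_neg_sq hn hs, ← integral_indicator hset, ← hV]
    have := integral_fun_norm_addHaar (volume : Measure V)
      (Set.indicator {y : ℝ | s ≤ y ^ 2} fun y => Real.exp (-y ^ 2))
    have e : ∀ x : V, Set.indicator {y : ℝ | s ≤ y ^ 2} (fun y => Real.exp (-y ^ 2)) ‖x‖
        = Set.indicator {x : V | s ≤ ‖x‖ ^ 2} (fun x => Real.exp (-‖x‖ ^ 2)) x := fun x => rfl
    simp_rw [e] at this
    rw [this]
    congr 2
    rw [← integral_indicator measurableSet_Ioi, ← integral_indicator measurableSet_Ioi]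
    refine integral_congr_ae ?_
    have h0 : ∀ᵐ y : ℝ, y ≠ √s := by simp [ae_iff]
    filter_upwards [h0] with y hys
    by_cases hy : 0 < y
    · have : s ≤ y ^ 2 ↔ √s < y := by
        rw [← Real.sqrt_le_left hy.le, lt_iff_le_and_ne, and_iff_left hys.symm]
      simp [Set.indicator_apply, hy, this]
    · have : ¬ √s < y := fun h => hy ((Real.sqrt_nonneg s).trans_lt h)
      simp [hy, this]
  have htot : ∫ x : V, Real.exp (-‖x‖ ^ 2)
      = (2 * n : ℕ) • (volume : Measure V).real (Metric.ball 0 1) • (2⁻¹ * upperGamma n 0) := by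
    rw [← hrad 0 le_rfl]
    simp
  rw [measureReal_def, isotropicGaussian, withDensity_apply _ hset,
    ← ofReal_integral_eq_lintegral_ofReal
      ((integrable_exp_neg_norm_sq V).const_mul _).integrableOn
      (Eventually.of_forall fun x => by positivity),
    integral_const_mul, ENNReal.toReal_ofReal (by positivity), hrad s hs, hG]
  rw [htot] at hpos ⊢
  simp only [nsmul_eq_mul, smul_eq_mul] at hpos ⊢
  have hb : (volume : Measure V).real (Metric.ball 0 1) ≠ 0 := by
    intro h
    simp [h] at hpos
  have hg : upperGamma n 0 ≠ 0 := by
    intro h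
    rw [h] at hpos
    simp at hpos
  field_simp

end IsotropicGaussian

/-! ### The law of a projected channel vector -/

open Complex in
lemma charFun_stdComplexGaussian (t : ℂ) :
    charFun stdComplexGaussian t = cexp (-(‖t‖ : ℂ) ^ 2 / 4) := by
  have hm : Measurable fun z : ℝ × ℝ => (⟨z.1, z.2⟩ : ℂ) :=
    measurableEquivRealProd.symm.measurable
  rw [charFun_apply, stdComplexGaussian, integral_map hm.aemeasurable (by fun_prop)]
  have hi : ∀ z : ℝ × ℝ, cexp ((inner ℝ (⟨z.1, z.2⟩ : ℂ) t : ℝ) * I)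
      = cexp (t.re * z.1 * I) * cexp (t.im * z.2 * I) := by
    intro z
    rw [← exp_add, Complex.inner]
    congr 1
    simp
    ring
  simp_rw [hi]
  rw [integral_prod_mul (fun x : ℝ => cexp (t.re * x * I)) (fun y : ℝ => cexp (t.im * y * I)),
    ← charFun_apply_real, ← charFun_apply_real, charFun_gaussianReal, charFun_gaussianReal,
    ← exp_add]
  congr 1
  have : (‖t‖ : ℂ) ^ 2 = (t.re : ℂ) ^ 2 + (t.im : ℂ) ^ 2 := by
    have := Complex.sq_norm t
    rw [normSq_apply] at this
    exact_mod_cast this.trans (by ring)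
  rw [this]
  push_cast
  ring

instance : IsProbabilityMeasure stdComplexGaussian :=
  Measure.isProbabilityMeasure_map
    (Complex.measurableEquivRealProd.symm.measurable.aemeasurable
      (f := fun z : ℝ × ℝ => (⟨z.1, z.2⟩ : ℂ)))

open Complex in
/-- The law of a channel vector is invariant under unitary maps; its coordinates with respect to an
orthonormal family are again i.i.d. `CN(0,1)`. -/
lemma map_inner_orthonormal {L n : ℕ} {b : Fin n → EuclideanSpace ℂ (Fin L)}
    (hb : Orthonormal ℂ b) :
    (Measure.pi fun _ : Fin L => stdComplexGaussian).map
      (fun y => (WithLp.toLp 2 fun i => inner ℂ (b i) (WithLp.toLp 2 y) :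
        EuclideanSpace ℂ (Fin n))) = isotropicGaussian (EuclideanSpace ℂ (Fin n)) := by
  have hm1 : Measurable fun x : EuclideanSpace ℂ (Fin L) =>
      (WithLp.toLp 2 fun i => inner ℂ (b i) x : EuclideanSpace ℂ (Fin n)) := by fun_prop
  have hm2 : Measurable (WithLp.toLp 2 : (Fin L → ℂ) → EuclideanSpace ℂ (Fin L)) := by fun_prop
  have : IsProbabilityMeasure ((Measure.pi fun _ : Fin L => stdComplexGaussian).map
      (fun y => (WithLp.toLp 2 fun i => inner ℂ (b i) (WithLp.toLp 2 y) :
        EuclideanSpace ℂ (Fin n)))) :=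
    Measure.isProbabilityMeasure_map (hm1.comp hm2).aemeasurable
  refine Measure.ext_of_charFun (funext fun t => ?_)
  have hcomp : (fun y : Fin L → ℂ => (WithLp.toLp 2 fun i => inner ℂ (b i) (WithLp.toLp 2 y) :
        EuclideanSpace ℂ (Fin n))) = (fun x : EuclideanSpace ℂ (Fin L) =>
      (WithLp.toLp 2 fun i => inner ℂ (b i) x : EuclideanSpace ℂ (Fin n))) ∘ WithLp.toLp 2 := rfl
  rw [charFun_isotropicGaussian, hcomp, ← Measure.map_map hm1 hm2, charFun_apply,
    integral_map hm1.aemeasurable (by fun_prop)]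
  have hinner : ∀ x : EuclideanSpace ℂ (Fin L),
      inner ℝ (WithLp.toLp 2 fun i => inner ℂ (b i) x : EuclideanSpace ℂ (Fin n)) t
        = inner ℝ x (∑ i, t i • b i) := by
    intro x
    have hre : ∀ (m : ℕ) (x y : EuclideanSpace ℂ (Fin m)),
        inner ℝ x y = (inner ℂ x y).re := by
      intro m x y
      simp [PiLp.inner_apply, Complex.inner]
    rw [hre, hre, inner_sum, PiLp.inner_apply]
    congr 1
    refine Finset.sum_congr rfl fun i _ => ?_
    rw [inner_smul_right]
    simp
  have hnorm : ‖∑ i, t i • b i‖ = ‖t‖ := by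
    have h1 : ‖∑ i, t i • b i‖ ^ 2 = ‖t‖ ^ 2 := by
      have h2 := hb.inner_sum (fun i => t i) (fun i => t i) Finset.univ
      rw [inner_self_eq_norm_sq_to_K] at h2
      rw [EuclideanSpace.norm_sq_eq t]
      have h3 : ((‖∑ i, t i • b i‖ ^ 2 : ℝ) : ℂ) = ((∑ i, ‖t i‖ ^ 2 : ℝ) : ℂ) := by
        push_cast
        refine h2.trans (Finset.sum_congr rfl fun i _ => ?_)
        rw [mul_comm, mul_conj, normSq_eq_norm_sq]
        push_cast
        rfl
      exact_mod_cast h3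
    exact (sq_eq_sq₀ (norm_nonneg _) (norm_nonneg _)).1 h1
  simp_rw [hinner]
  rw [← charFun_apply, charFun_pi]
  simp_rw [charFun_stdComplexGaussian]
  rw [← Complex.exp_sum, ← Finset.sum_div, Finset.sum_neg_distrib, ← hnorm]
  have h4 := EuclideanSpace.norm_sq_eq (∑ i, t i • b i)
  congr 3
  exact_mod_cast h4.symm

/-! ### Zero-forcing beamforming -/

section ZeroForcing

variable {L : ℕ}

/-- The optimal zero-forcing beam points along the projection of the channel vector on the
orthogonal complement of the interference space. -/
lemma zfPower_eq_norm_sq (h : Channel L) (v : Finset (Fin L)) (ℓ : Fin L) :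
    zfPower h v ℓ = ‖(interferenceSpace h v ℓ)ᗮ.starProjection (channelVec h ℓ)‖ ^ 2 := by
  set U := (interferenceSpace h v ℓ)ᗮ
  set p := U.starProjection (channelVec h ℓ) with hp
  have hpU : p ∈ U := U.starProjection_apply_mem _
  have hinner : ∀ f ∈ U, inner ℂ f (channelVec h ℓ) = inner ℂ f p := by
    intro f hf
    have := U.starProjection_inner_eq_zero (channelVec h ℓ) f hf
    rw [← sub_eq_zero, ← inner_sub_right, ← inner_conj_symm, this, map_zero]
  have hle : ∀ g ∈ {g : ℝ | ∃ f : EuclideanSpace ℂ (Fin L),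
      f ∈ U ∧ ‖f‖ = 1 ∧ g = ‖inner ℂ f (channelVec h ℓ)‖ ^ 2}, g ≤ ‖p‖ ^ 2 := by
    rintro g ⟨f, hf, hf1, rfl⟩
    rw [hinner f hf]
    gcongr
    simpa [hf1] using norm_inner_le_norm (𝕜 := ℂ) f p
  refine le_antisymm (Real.sSup_le hle (sq_nonneg _)) ?_
  by_cases hp0 : p = 0
  · rw [hp0, norm_zero, zero_pow two_ne_zero]
    refine Real.sSup_nonneg ?_
    rintro g ⟨f, -, -, rfl⟩
    positivity
  refine le_csSup ⟨_, hle⟩ ⟨((‖p‖⁻¹ : ℝ) : ℂ) • p, U.smul_mem _ hpU, ?_, ?_⟩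
  · rw [norm_smul, Complex.norm_real, norm_inv, norm_norm, inv_mul_cancel₀ (norm_ne_zero_iff.2 hp0)]
  · have hne : ‖p‖ ≠ 0 := norm_ne_zero_iff.2 hp0
    rw [hinner _ (U.smul_mem _ hpU), inner_smul_left, inner_self_eq_norm_sq_to_K, norm_mul,
      Complex.conj_ofReal, Complex.norm_real, norm_inv, norm_norm]
    simp only [norm_pow, RCLike.norm_ofReal, abs_norm]
    field_simp

lemma interferenceSpace_eq_span_range (h : Channel L) (v : Finset (Fin L)) (ℓ : Fin L) :
    interferenceSpace h v ℓ = Submodule.span ℂ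
      (Set.range fun m => if m ∈ v ∧ m ≠ ℓ then channelVec h m else 0) := by
  refine le_antisymm (Submodule.span_le.2 ?_) (Submodule.span_le.2 ?_)
  · rintro x ⟨m, hm, hml, rfl⟩
    exact Submodule.subset_span ⟨m, by simp [hm, hml]⟩
  · rintro x ⟨m, rfl⟩
    by_cases hm : m ∈ v ∧ m ≠ ℓ
    · exact Submodule.subset_span ⟨m, hm.1, hm.2, by simp [hm]⟩
    · simp [hm]

/-- The received power is the squared distance to the interference space, an infimum over countably
many coefficient vectors. -/
lemma zfPower_eq_iInf (h : Channel L) (v : Finset (Fin L)) (ℓ : Fin L) :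
    zfPower h v ℓ = (⨅ n : ℕ, ‖channelVec h ℓ - ∑ m, TopologicalSpace.denseSeq (Fin L → ℂ) n m •
      (if m ∈ v ∧ m ≠ ℓ then channelVec h m else 0)‖) ^ 2 := by
  rw [zfPower_eq_norm_sq, Submodule.starProjection_orthogonal_val, Submodule.starProjection_minimal]
  congr 1
  have hbdd : BddBelow (Set.range fun x : interferenceSpace h v ℓ =>
      ‖channelVec h ℓ - (x : EuclideanSpace ℂ (Fin L))‖) :=
    ⟨0, by rintro _ ⟨x, rfl⟩; positivity⟩
  have hbdd' : BddBelow (Set.range fun n : ℕ => ‖channelVec h ℓ -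
      ∑ m, TopologicalSpace.denseSeq (Fin L → ℂ) n m •
        (if m ∈ v ∧ m ≠ ℓ then channelVec h m else 0)‖) :=
    ⟨0, by rintro _ ⟨x, rfl⟩; positivity⟩
  refine le_antisymm (le_ciInf fun n => ?_) (le_ciInf fun x => ?_)
  · refine ciInf_le hbdd ⟨∑ m, TopologicalSpace.denseSeq (Fin L → ℂ) n m •
      (if m ∈ v ∧ m ≠ ℓ then channelVec h m else 0), ?_⟩
    rw [interferenceSpace_eq_span_range]
    exact Submodule.sum_mem _ fun m _ => Submodule.smul_mem _ _ (Submodule.subset_span ⟨m, rfl⟩)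
  · obtain ⟨x, hx⟩ := x
    rw [interferenceSpace_eq_span_range, Submodule.mem_span_range_iff_exists_fun] at hx
    obtain ⟨c, rfl⟩ := hx
    refine (TopologicalSpace.denseRange_denseSeq (Fin L → ℂ)).induction_on
      (p := fun c => _ ≤ ‖channelVec h ℓ - ∑ m, c m •
        (if m ∈ v ∧ m ≠ ℓ then channelVec h m else 0)‖) c ?_ fun n => ciInf_le hbdd' n
    exact isClosed_le continuous_const (by fun_prop)

lemma measurable_snr (P : ℝ) (v : Finset (Fin L)) (ℓ : Fin L) :
    Measurable fun h : Channel L => snr P h v ℓ := by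
  unfold snr
  simp_rw [zfPower_eq_iInf]
  refine Measurable.const_mul (Measurable.pow_const (Measurable.iInf fun n => ?_) _) _
  have hc : ∀ m : Fin L, Measurable fun h : Channel L => channelVec h m := fun m => by
    unfold channelVec
    fun_prop
  refine ((hc ℓ).sub (Finset.measurable_sum _ fun m _ => ?_)).norm
  by_cases hm : m ∈ v ∧ m ≠ ℓ
  · simp only [hm, ne_eq, not_false_eq_true, and_self, if_true]
    exact (hc m).const_smul (TopologicalSpace.denseSeq (Fin L → ℂ) n m)
  · simp only [hm, if_false]
    exact measurable_const

lemma measurableSet_le_snr (P θ : ℝ) (v : Finset (Fin L)) (ℓ : Fin L) :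
    MeasurableSet {h : Channel L | θ ≤ snr P h v ℓ} :=
  measurableSet_le measurable_const (measurable_snr P v ℓ)

variable (L) in
/-- The law of the channel matrix in one slot. -/
noncomputable def channelLaw : Measure (Channel L) :=
  Measure.pi fun _ : Fin L => Measure.pi fun _ : Fin L => stdComplexGaussian

instance : IsProbabilityMeasure (channelLaw L) := by
  unfold channelLaw
  infer_instance

lemma finrank_interferenceSpace_le (h : Channel L) {v : Finset (Fin L)} {ℓ : Fin L} (hℓ : ℓ ∈ v) :
    Module.finrank ℂ (interferenceSpace h v ℓ) + 1 ≤ v.card := by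
  classical
  have hset : {x | ∃ m ∈ v, m ≠ ℓ ∧ x = channelVec h m}
      = (((v.erase ℓ).image (channelVec h) : Finset _) : Set (EuclideanSpace ℂ (Fin L))) := by
    ext x
    simp only [Set.mem_ofPred_eq, Finset.coe_image, Set.mem_image, Finset.mem_coe, Finset.mem_erase]
    constructor
    · rintro ⟨m, hm, hml, rfl⟩
      exact ⟨m, ⟨hml, hm⟩, rfl⟩
    · rintro ⟨m, ⟨hml, hm⟩, rfl⟩
      exact ⟨m, hm, hml, rfl⟩
  have h1 : Module.finrank ℂ (interferenceSpace h v ℓ) ≤ (v.erase ℓ).card := by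
    unfold interferenceSpace
    rw [hset]
    exact (finrank_span_finset_le_card _).trans Finset.card_image_le
  have h2 := Finset.card_erase_add_one hℓ
  omega

/-- Given the channels of the other users, a scheduled user succeeds at least with the probability
`d(|v|)`: its channel vector is projected on a space of dimension at least `L - |v| + 1`. -/
lemma depRate_le_measure_update {P θ : ℝ} (hP : 0 < P) (hθ : 0 < θ) {v : Finset (Fin L)}
    {ℓ : Fin L} (hℓ : ℓ ∈ v) (x : Channel L) :
    ENNReal.ofReal (depRate L P θ v.card) ≤ (Measure.pi fun _ : Fin L => stdComplexGaussian)
      {y | θ ≤ snr P (Function.update x ℓ y) v ℓ} := by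
  set K := interferenceSpace x v ℓ with hK
  have hKy : ∀ y, interferenceSpace (Function.update x ℓ y) v ℓ = K := by
    intro y
    rw [hK, interferenceSpace, interferenceSpace]
    congr 1
    ext z
    refine exists_congr fun m => and_congr_right fun _ => and_congr_right fun hm => ?_
    rw [channelVec, channelVec, Function.update_of_ne hm]
  have hk1 : 1 ≤ v.card := Finset.card_pos.2 ⟨ℓ, hℓ⟩
  have hkL : v.card ≤ L := by simpa using Finset.card_le_univ v
  obtain ⟨n, hn⟩ : ∃ n, n + v.card = L + 1 := ⟨L + 1 - v.card, by omega⟩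
  have hdim : n ≤ Module.finrank ℂ Kᗮ := by
    have h1 := K.finrank_add_finrank_orthogonal
    have h2 := finrank_interferenceSpace_le x hℓ
    rw [finrank_euclideanSpace_fin] at h1
    rw [← hK] at h2
    omega
  set b : Fin n → EuclideanSpace ℂ (Fin L) := fun i =>
    (stdOrthonormalBasis ℂ Kᗮ (Fin.castLE hdim i) : EuclideanSpace ℂ (Fin L)) with hb
  have hbK : ∀ i, b i ∈ Kᗮ := fun i => Subtype.prop _
  have hortho : Orthonormal ℂ b :=
    ((stdOrthonormalBasis ℂ Kᗮ).orthonormal.comp _ (Fin.castLE_injective hdim)).comp_linearIsometry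
      Kᗮ.subtypeₗᵢ
  have hV : Module.finrank ℝ (EuclideanSpace ℂ (Fin n)) = 2 * n := by
    rw [finrank_real_of_complex, finrank_euclideanSpace_fin]
  set s : ℝ := v.card * θ / P with hs
  have hs0 : 0 ≤ s := by positivity
  have hlaw := isotropicGaussian_le_norm_sq (V := EuclideanSpace ℂ (Fin n)) (by omega) hV hs0
  have hnR : (n : ℝ) = L - v.card + 1 := by
    have : (n : ℝ) + v.card = L + 1 := by exact_mod_cast hn
    linarith
  have hrate : depRate L P θ v.card
      = (isotropicGaussian (EuclideanSpace ℂ (Fin n))).real {x | s ≤ ‖x‖ ^ 2} := by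
    rw [hlaw, depRate, hnR]
  have hm : Measurable fun y : Fin L → ℂ => (WithLp.toLp 2 fun i =>
      inner ℂ (b i) (WithLp.toLp 2 y : EuclideanSpace ℂ (Fin L)) : EuclideanSpace ℂ (Fin n)) := by
    fun_prop
  rw [hrate, ofReal_measureReal, ← map_inner_orthonormal hortho,
    Measure.map_apply hm (measurableSet_le measurable_const (by fun_prop))]
  refine measure_mono fun y hy => ?_
  simp only [Set.mem_preimage, Set.mem_ofPred_eq] at hy ⊢
  have hpow : s ≤ zfPower (Function.update x ℓ y) v ℓ := by
    refine hy.trans ?_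
    have hcv : channelVec (Function.update x ℓ y) ℓ = WithLp.toLp 2 y := by
      simp [channelVec]
    rw [zfPower_eq_norm_sq, hKy, hcv, EuclideanSpace.norm_sq_eq]
    refine le_trans (le_of_eq ?_) (Orthonormal.sum_inner_products_le (s := Finset.univ) _ hortho)
    refine Finset.sum_congr rfl fun i _ => ?_
    have := Kᗮ.starProjection_inner_eq_zero (WithLp.toLp 2 y) (b i) (hbK i)
    congr 2
    change inner ℂ (b i) _ = _
    rw [← sub_eq_zero, ← inner_sub_right, ← inner_conj_symm, this, map_zero]
  have hc : (0 : ℝ) < v.card := by exact_mod_cast hk1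
  calc θ = P / v.card * s := by rw [hs]; field_simp
    _ ≤ _ := mul_le_mul_of_nonneg_left hpow (by positivity)

/-- A scheduled user succeeds at least with the probability `d(|v|)`. (The inequality, which is an
equality, suffices for stability and makes the almost sure linear independence of the channel
vectors unnecessary.) -/
theorem depRate_le_channelLaw {P θ : ℝ} (hP : 0 < P) (hθ : 0 < θ) {v : Finset (Fin L)}
    {ℓ : Fin L} (hℓ : ℓ ∈ v) :
    ENNReal.ofReal (depRate L P θ v.card) ≤ channelLaw L {h | θ ≤ snr P h v ℓ} := by
  have hset := measurableSet_le_snr P θ v ℓ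
  have h := lintegral_le_of_lmarginal_le
    (μ := fun _ : Fin L => Measure.pi fun _ : Fin L => stdComplexGaussian) {ℓ}
    (f := fun _ => ENNReal.ofReal (depRate L P θ v.card))
    (g := {h | θ ≤ snr P h v ℓ}.indicator 1) measurable_const (measurable_one.indicator hset)
    (fun x => by
      rw [lmarginal_singleton, lmarginal_singleton, lintegral_const, measure_univ, mul_one]
      refine (depRate_le_measure_update hP hθ hℓ x).trans (le_of_eq ?_)
      have hset' : MeasurableSet {y : Fin L → ℂ | θ ≤ snr P (Function.update x ℓ y) v ℓ} :=
        (measurable_update x) hset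
      rw [← lintegral_indicator_one hset']
      rfl)
  rwa [lintegral_const, measure_univ, mul_one, lintegral_indicator_one hset] at h

lemma depRate_pos {P θ : ℝ} (hP : 0 < P) (hθ : 0 < θ) {k : ℕ} (hk : k ≤ L) :
    0 < depRate L P θ k := by
  have ha : (0 : ℝ) < (L : ℝ) - k + 1 := by
    have : (k : ℝ) ≤ L := by exact_mod_cast hk
    linarith
  have hb : 0 ≤ k * θ / P := by positivity
  refine div_pos ?_ (Real.Gamma_pos_of_pos ha)
  have hint : IntegrableOn (fun t : ℝ => t ^ ((L : ℝ) - k + 1 - 1) * Real.exp (-t))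
      (Set.Ioi (k * θ / P)) :=
    ((Real.GammaIntegral_convergent ha).mono_set (Set.Ioi_subset_Ioi hb)).congr_fun
      (fun t _ => mul_comm _ _) measurableSet_Ioi
  have hpos : ∀ t ∈ Set.Ioi (k * θ / P), 0 < t ^ ((L : ℝ) - k + 1 - 1) * Real.exp (-t) :=
    fun t ht => mul_pos (Real.rpow_pos_of_pos (hb.trans_lt ht) _) (Real.exp_pos _)
  rw [upperGamma, setIntegral_pos_iff_support_of_nonneg_ae
    ((ae_restrict_iff' measurableSet_Ioi).2 (Eventually.of_forall fun t ht => (hpos t ht).le)) hint]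
  refine lt_of_lt_of_le ?_ (measure_mono (s := Set.Ioi (k * θ / P)) fun t ht =>
    ⟨(hpos t ht).ne', ht⟩)
  simp

end ZeroForcing

/-! ### One slot of the queueing system -/

section Drift

variable {L : ℕ}

open Classical in
/-- The queue lengths after a slot with arrivals `a` and channels `h`. -/
noncomputable def nextQueue (P θ : ℝ) (π : Policy L) (q : Fin L → ℕ) (a : Fin L → ℕ)
    (h : Channel L) : Fin L → ℕ :=
  fun ℓ => (q ℓ - if ℓ ∈ π q ∧ θ ≤ snr P h (π q) ℓ then 1 else 0) + a ℓ

lemma queueLength_succ (P θ : ℝ) (π : Policy L) (q₀ : Fin L → ℕ) (a : ℕ → Fin L → ℕ)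
    (h : ℕ → Channel L) (t : ℕ) :
    queueLength P θ π q₀ a h (t + 1)
      = nextQueue P θ π (queueLength P θ π q₀ a h t) (a t) (h t) := rfl

lemma measurable_nextQueue (P θ : ℝ) (π : Policy L) :
    Measurable fun z : (Fin L → ℕ) × (Fin L → ℕ) × Channel L =>
      nextQueue P θ π z.1 z.2.1 z.2.2 := by
  refine measurable_from_prod_countable_right fun q => measurable_pi_lambda _ fun ℓ => ?_
  refine Measurable.add (Measurable.const_sub ?_ _) (by fun_prop)
  by_cases hℓ : ℓ ∈ π q
  · simp only [hℓ, true_and]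
    exact Measurable.ite (measurable_snd (measurableSet_le_snr P θ (π q) ℓ))
      measurable_const measurable_const
  · simp [hℓ]

/-- The transition laws of the queue-length process when `α` is the law of the arrivals. -/
noncomputable def queueKernel (P θ : ℝ) (π : Policy L) (α : Measure (Fin L → ℕ))
    (q : Fin L → ℕ) : Measure (Fin L → ℕ) :=
  (α.prod (channelLaw L)).map fun e => nextQueue P θ π q e.1 e.2

variable {P θ : ℝ} {π : Policy L}

lemma measurable_nextQueue_apply (q : Fin L → ℕ) :
    Measurable fun e : (Fin L → ℕ) × Channel L => nextQueue P θ π q e.1 e.2 :=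
  (measurable_nextQueue P θ π).comp measurable_prodMk_left

instance (α : Measure (Fin L → ℕ)) [IsProbabilityMeasure α] (q : Fin L → ℕ) :
    IsProbabilityMeasure (queueKernel P θ π α q) :=
  Measure.isProbabilityMeasure_map (measurable_nextQueue_apply q).aemeasurable

lemma step_queueKernel (α : Measure (Fin L → ℕ)) (f : (Fin L → ℕ) → ℝ≥0∞) (q : Fin L → ℕ) :
    step (queueKernel P θ π α) f q
      = ∫⁻ e, f (nextQueue P θ π q e.1 e.2) ∂α.prod (channelLaw L) :=
  lintegral_map .of_discrete (measurable_nextQueue_apply q)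

/-- The Euclidean norm of the vector of queue lengths. -/
noncomputable def queueNorm (q : Fin L → ℕ) : ℝ := √(∑ ℓ, (q ℓ : ℝ) ^ 2)

lemma queueNorm_nonneg (q : Fin L → ℕ) : 0 ≤ queueNorm q := Real.sqrt_nonneg _

lemma queueNorm_sq (q : Fin L → ℕ) : queueNorm q ^ 2 = ∑ ℓ, (q ℓ : ℝ) ^ 2 :=
  Real.sq_sqrt (Finset.sum_nonneg fun _ _ => sq_nonneg _)

lemma le_queueNorm (q : Fin L → ℕ) (ℓ : Fin L) : (q ℓ : ℝ) ≤ queueNorm q :=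
  Real.le_sqrt_of_sq_le
    (Finset.single_le_sum (f := fun ℓ => (q ℓ : ℝ) ^ 2) (fun _ _ => sq_nonneg _)
      (Finset.mem_univ ℓ))

lemma queueNorm_le_sum (q : Fin L → ℕ) : queueNorm q ≤ ∑ ℓ, (q ℓ : ℝ) :=
  Real.sqrt_le_iff.2 ⟨Finset.sum_nonneg fun _ _ => Nat.cast_nonneg _,
    Finset.sum_sq_le_sq_sum_of_nonneg fun _ _ => Nat.cast_nonneg _⟩

lemma finite_queueNorm_lt (R : ℝ) : {q : Fin L → ℕ | queueNorm q < R}.Finite := by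
  refine (Set.finite_Iic fun _ : Fin L => ⌈R⌉₊).subset fun q hq ℓ => ?_
  have : (q ℓ : ℝ) ≤ ⌈R⌉₊ := ((le_queueNorm q ℓ).trans (le_of_lt hq)).trans (Nat.le_ceil R)
  exact_mod_cast this

/-- A bound for the change of the queue lengths in a slot with arrivals `a`. -/
def changeBound (a : Fin L → ℕ) : ℝ := ∑ ℓ, (a ℓ : ℝ) + L

lemma changeBound_nonneg (a : Fin L → ℕ) : 0 ≤ changeBound a := by
  unfold changeBound
  positivity

open Classical in
/-- The indicator of the success of user `ℓ`, regardless of the contents of its queue. -/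
noncomputable def success (P θ : ℝ) (v : Finset (Fin L)) (h : Channel L) (ℓ : Fin L) : ℝ :=
  if ℓ ∈ v ∧ θ ≤ snr P h v ℓ then 1 else 0

lemma success_nonneg (v : Finset (Fin L)) (h : Channel L) (ℓ : Fin L) :
    0 ≤ success P θ v h ℓ := by
  unfold success
  split_ifs <;> simp

lemma success_le_one (v : Finset (Fin L)) (h : Channel L) (ℓ : Fin L) :
    success P θ v h ℓ ≤ 1 := by
  unfold success
  split_ifs <;> simp

/-- An empty queue loses no packet, but the product of its length and its departures is not
affected by this. -/
lemma exists_departures (q a : Fin L → ℕ) (h : Channel L) :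
    ∃ D : Fin L → ℝ, (∀ ℓ, 0 ≤ D ℓ ∧ D ℓ ≤ 1) ∧
      (∀ ℓ, (q ℓ : ℝ) * D ℓ = q ℓ * success P θ (π q) h ℓ) ∧
      ∀ ℓ, (nextQueue P θ π q a h ℓ : ℝ) = q ℓ + (a ℓ - D ℓ) := by
  refine ⟨fun ℓ => if q ℓ = 0 then 0 else success P θ (π q) h ℓ, fun ℓ => ?_, fun ℓ => ?_,
    fun ℓ => ?_⟩
  · dsimp only
    split_ifs
    · simp
    · exact ⟨success_nonneg _ _ _, success_le_one _ _ _⟩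
  · by_cases hq : q ℓ = 0 <;> simp [hq]
  · by_cases hq : q ℓ = 0
    · simp [nextQueue, hq]
    · simp only [nextQueue, success, if_neg hq]
      split_ifs
      · push_cast [Nat.one_le_iff_ne_zero.2 hq]
        ring
      · push_cast
        simp

lemma sum_abs_le_changeBound {a : Fin L → ℕ} {D : Fin L → ℝ} (hD : ∀ ℓ, 0 ≤ D ℓ ∧ D ℓ ≤ 1) :
    ∑ ℓ, |(a ℓ : ℝ) - D ℓ| ≤ changeBound a := by
  have : changeBound a = ∑ ℓ, ((a ℓ : ℝ) + 1) := by simp [changeBound, Finset.sum_add_distrib]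
  rw [this]
  refine Finset.sum_le_sum fun ℓ _ => ?_
  have h0 : (0 : ℝ) ≤ a ℓ := Nat.cast_nonneg _
  rw [abs_le]
  constructor <;> linarith [(hD ℓ).1, (hD ℓ).2]

lemma abs_sum_mul_le {q a : Fin L → ℕ} {D : Fin L → ℝ} (hD : ∀ ℓ, 0 ≤ D ℓ ∧ D ℓ ≤ 1) :
    |∑ ℓ, (q ℓ : ℝ) * (a ℓ - D ℓ)| ≤ queueNorm q * changeBound a := by
  refine (Finset.abs_sum_le_sum_abs _ _).trans ?_
  refine le_trans ?_ (mul_le_mul_of_nonneg_left (sum_abs_le_changeBound hD) (queueNorm_nonneg q))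
  rw [Finset.mul_sum]
  refine Finset.sum_le_sum fun ℓ _ => ?_
  rw [abs_mul, Nat.abs_cast]
  exact mul_le_mul_of_nonneg_right (le_queueNorm q ℓ) (abs_nonneg _)

lemma queueNorm_nextQueue_sq_le (q a : Fin L → ℕ) (h : Channel L) :
    queueNorm (nextQueue P θ π q a h) ^ 2 ≤ queueNorm q ^ 2 +
      2 * ∑ ℓ, (q ℓ : ℝ) * (a ℓ - success P θ (π q) h ℓ) + changeBound a ^ 2 := by
  obtain ⟨D, hD, hqD, hnext⟩ := exists_departures (P := P) (θ := θ) (π := π) q a h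
  have h1 : ∑ ℓ, ((a ℓ : ℝ) - D ℓ) ^ 2 ≤ changeBound a ^ 2 := by
    refine le_trans ?_ (pow_le_pow_left₀ (Finset.sum_nonneg fun _ _ => abs_nonneg _)
      (sum_abs_le_changeBound hD) 2)
    simp_rw [← sq_abs ((a _ : ℝ) - D _)]
    exact Finset.sum_sq_le_sq_sum_of_nonneg fun _ _ => abs_nonneg _
  have h2 : ∑ ℓ, (q ℓ : ℝ) * (a ℓ - success P θ (π q) h ℓ) = ∑ ℓ, (q ℓ : ℝ) * (a ℓ - D ℓ) := by
    refine Finset.sum_congr rfl fun ℓ _ => ?_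
    rw [mul_sub, mul_sub, hqD]
  rw [queueNorm_sq, queueNorm_sq, h2]
  have h3 : ∑ ℓ, (nextQueue P θ π q a h ℓ : ℝ) ^ 2 = ∑ ℓ, (q ℓ : ℝ) ^ 2
      + 2 * ∑ ℓ, (q ℓ : ℝ) * (a ℓ - D ℓ) + ∑ ℓ, ((a ℓ : ℝ) - D ℓ) ^ 2 := by
    rw [Finset.mul_sum, ← Finset.sum_add_distrib, ← Finset.sum_add_distrib]
    refine Finset.sum_congr rfl fun ℓ _ => ?_
    rw [hnext]
    ring
  linarith

lemma success_mem (v : Finset (Fin L)) (h : Channel L) (ℓ : Fin L) :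
    0 ≤ success P θ v h ℓ ∧ success P θ v h ℓ ≤ 1 :=
  ⟨success_nonneg v h ℓ, success_le_one v h ℓ⟩

lemma queueNorm_nextQueue_le (q a : Fin L → ℕ) (h : Channel L) :
    queueNorm (nextQueue P θ π q a h) ≤ queueNorm q + changeBound a := by
  have h1 := queueNorm_nextQueue_sq_le (P := P) (θ := θ) (π := π) q a h
  have h2 := (abs_le.1 (abs_sum_mul_le (q := q) (a := a)
    (success_mem (P := P) (θ := θ) (π q) h))).2
  refine abs_le_of_sq_le_sq' (h1.trans ?_)
    (add_nonneg (queueNorm_nonneg q) (changeBound_nonneg a)) |>.2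
  nlinarith

/-- The change of the norm is at most its linearization, up to an error that vanishes for long
queues and is dominated by the integrable change of the queue lengths. -/
lemma queueNorm_nextQueue_le_linear {q : Fin L → ℕ} (hq : 0 < queueNorm q) (a : Fin L → ℕ)
    (h : Channel L) :
    queueNorm (nextQueue P θ π q a h) ≤ queueNorm q +
      (∑ ℓ, (q ℓ : ℝ) * (a ℓ - success P θ (π q) h ℓ)) / queueNorm q +
      min (changeBound a ^ 2 / (2 * queueNorm q)) (2 * changeBound a) := by
  have h1 := queueNorm_nextQueue_sq_le (P := P) (θ := θ) (π := π) q a h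
  have h2 := (abs_le.1 (abs_sum_mul_le (q := q) (a := a)
    (success_mem (P := P) (θ := θ) (π q) h))).1
  have h3 := queueNorm_nextQueue_le (P := P) (θ := θ) (π := π) q a h
  have h4 := queueNorm_nonneg (nextQueue P θ π q a h)
  set R := queueNorm q
  set c := ∑ ℓ, (q ℓ : ℝ) * (a ℓ - success P θ (π q) h ℓ)
  set B := changeBound a
  set N := queueNorm (nextQueue P θ π q a h)
  rw [← sub_le_iff_le_add', le_min_iff]
  constructor
  · -- `√(R² + x) ≤ R + x / (2 R)` with `x = 2 c + B²`
    have hy : R * (c / R + B ^ 2 / (2 * R)) = c + B ^ 2 / 2 := by field_simp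
    set y := c / R + B ^ 2 / (2 * R) with hydef
    have hN : N ^ 2 ≤ R ^ 2 + 2 * (R * y) := by rw [hy]; linarith
    have hRy : 0 ≤ R + y := by
      by_contra! hneg
      nlinarith [sq_nonneg N]
    have : N ≤ R + y := abs_le_of_sq_le_sq' (hN.trans (by nlinarith [sq_nonneg y])) hRy |>.2
    linarith
  · have : -B ≤ c / R := by
      rw [le_div_iff₀ hq]
      linarith
    linarith

/-! ### The drift of the Euclidean norm -/

lemma sum_mul_depVec (q : Fin L → ℕ) (v : Finset (Fin L)) :
    ∑ ℓ, (q ℓ : ℝ) * depVec P θ v ℓ = weight P θ q v := by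
  simp only [depVec, weight, mul_ite, mul_zero, Finset.sum_ite_mem, Finset.univ_inter]
  rw [Finset.mul_sum]
  exact Finset.sum_congr rfl fun _ _ => mul_comm _ _

/-- The policy attains at least the weighted rate of each vector of the stability region. -/
lemma sum_mul_le_weight (hπ : IsMaxWeight P θ π) {r : Fin L → ℝ} (hr : r ∈ stabilityRegion L P θ)
    (q : Fin L → ℕ) : ∑ ℓ, (q ℓ : ℝ) * r ℓ ≤ weight P θ q (π q) := by
  obtain ⟨p, hp0, hp1, hrp⟩ := hr
  calc ∑ ℓ, (q ℓ : ℝ) * r ℓ ≤ ∑ ℓ, (q ℓ : ℝ) * ∑ v, p v * depVec P θ v ℓ :=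
        Finset.sum_le_sum fun ℓ _ => mul_le_mul_of_nonneg_left (hrp ℓ).2 (Nat.cast_nonneg _)
    _ = ∑ v, p v * ∑ ℓ, (q ℓ : ℝ) * depVec P θ v ℓ := by
        simp_rw [Finset.mul_sum]
        rw [Finset.sum_comm]
        exact Finset.sum_congr rfl fun _ _ => Finset.sum_congr rfl fun _ _ => by ring
    _ ≤ ∑ v, p v * weight P θ q (π q) :=
        Finset.sum_le_sum fun v _ => mul_le_mul_of_nonneg_left (sum_mul_depVec q v ▸ hπ q v) (hp0 v)
    _ = weight P θ q (π q) := by rw [← Finset.sum_mul, hp1, one_mul]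

lemma measurable_success (v : Finset (Fin L)) (ℓ : Fin L) :
    Measurable fun h : Channel L => success P θ v h ℓ := by
  unfold success
  by_cases hℓ : ℓ ∈ v
  · simp only [hℓ, true_and]
    exact Measurable.ite (measurableSet_le_snr P θ v ℓ) measurable_const measurable_const
  · simp [hℓ]

lemma integrable_success (v : Finset (Fin L)) (ℓ : Fin L) :
    Integrable (fun h : Channel L => success P θ v h ℓ) (channelLaw L) :=
  Integrable.of_bound (measurable_success v ℓ).aestronglyMeasurable 1
    (Eventually.of_forall fun h => by
      rw [Real.norm_eq_abs, abs_of_nonneg (success_nonneg v h ℓ)]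
      exact success_le_one v h ℓ)

lemma depVec_le_integral_success (hP : 0 < P) (hθ : 0 < θ) (v : Finset (Fin L)) (ℓ : Fin L) :
    depVec P θ v ℓ ≤ ∫ h, success P θ v h ℓ ∂channelLaw L := by
  by_cases hℓ : ℓ ∈ v
  · have h1 := depRate_le_channelLaw hP hθ hℓ
    rw [ENNReal.ofReal_le_iff_le_toReal (measure_ne_top _ _)] at h1
    have h2 : (fun h : Channel L => success P θ v h ℓ)
        = {h : Channel L | θ ≤ snr P h v ℓ}.indicator 1 := by
      ext h
      simp [success, hℓ, Set.indicator_apply]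
    rw [depVec, if_pos hℓ, h2, integral_indicator_one (measurableSet_le_snr P θ v ℓ)]
    exact h1
  · rw [depVec, if_neg hℓ]
    exact integral_nonneg fun h => success_nonneg v h ℓ

variable {α : Measure (Fin L → ℕ)} [IsProbabilityMeasure α]

lemma integrable_changeBound (hα : ∀ ℓ, Integrable (fun a : Fin L → ℕ => (a ℓ : ℝ)) α) :
    Integrable changeBound α :=
  (integrable_finsetSum _ fun ℓ _ => hα ℓ).add (integrable_const _)

lemma integrable_queueNorm_nextQueue
    (hα : ∀ ℓ, Integrable (fun a : Fin L → ℕ => (a ℓ : ℝ)) α) (q : Fin L → ℕ) :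
    Integrable (fun e : (Fin L → ℕ) × Channel L => queueNorm (nextQueue P θ π q e.1 e.2))
      (α.prod (channelLaw L)) := by
  refine ((integrable_const (queueNorm q)).add ((integrable_changeBound hα).comp_fst _)).mono'
    ((Measurable.of_discrete (f := queueNorm)).comp
      (measurable_nextQueue_apply q)).aestronglyMeasurable (Eventually.of_forall fun e => ?_)
  rw [Real.norm_eq_abs, abs_of_nonneg (queueNorm_nonneg _)]
  exact queueNorm_nextQueue_le q e.1 e.2

lemma tendsto_integral_min_changeBound
    (hα : ∀ ℓ, Integrable (fun a : Fin L → ℕ => (a ℓ : ℝ)) α) :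
    Tendsto (fun R : ℝ => ∫ a, min (changeBound a ^ 2 / (2 * R)) (2 * changeBound a) ∂α) atTop
      (𝓝 0) := by
  have hB := integrable_changeBound hα
  have h := tendsto_integral_filter_of_dominated_convergence (μ := α) (l := (atTop : Filter ℝ))
    (F := fun R a => min (changeBound a ^ 2 / (2 * R)) (2 * changeBound a)) (f := fun _ => 0)
    (fun a => 2 * changeBound a)
    (Eventually.of_forall fun R => (Measurable.of_discrete).aestronglyMeasurable) ?_
    (hB.const_mul 2) (Eventually.of_forall fun a => ?_)
  · simpa using h
  · filter_upwards [eventually_ge_atTop 0] with R hR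
    refine Eventually.of_forall fun a => ?_
    have := changeBound_nonneg a
    rw [Real.norm_eq_abs, abs_of_nonneg (le_min (by positivity) (by positivity))]
    exact min_le_right _ _
  · have h1 : Tendsto (fun R : ℝ => changeBound a ^ 2 / (2 * R)) atTop (𝓝 0) :=
      tendsto_const_nhds.div_atTop (tendsto_id.const_mul_atTop two_pos)
    refine squeeze_zero' ?_ (Eventually.of_forall fun R => min_le_left _ _) h1
    filter_upwards [eventually_ge_atTop 0] with R hR
    have := changeBound_nonneg a
    exact le_min (by positivity) (by positivity)

/-- The mean change of the norm of the queue lengths under a policy of maximal weight, when the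
arrival rates are smaller by `δ` than a vector of the stability region. -/
lemma integral_queueNorm_le (hP : 0 < P) (hθ : 0 < θ) (hπ : IsMaxWeight P θ π)
    (hα : ∀ ℓ, Integrable (fun a : Fin L → ℕ => (a ℓ : ℝ)) α) {r' : Fin L → ℝ}
    (hr' : r' ∈ stabilityRegion L P θ) {δ : ℝ}
    (hδ : ∀ ℓ, ∫ a, (a ℓ : ℝ) ∂α + δ ≤ r' ℓ) (hδ0 : 0 ≤ δ) {q : Fin L → ℕ}
    (hq : 0 < queueNorm q) :
    ∫ e, queueNorm (nextQueue P θ π q e.1 e.2) ∂α.prod (channelLaw L) ≤ queueNorm q - δ +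
      ∫ a, min (changeBound a ^ 2 / (2 * queueNorm q)) (2 * changeBound a) ∂α := by
  set γ := channelLaw L
  set R := queueNorm q
  have hB := integrable_changeBound hα
  have hmin : Integrable (fun a : Fin L → ℕ =>
      min (changeBound a ^ 2 / (2 * R)) (2 * changeBound a)) α := by
    refine (hB.const_mul 2).mono' (Measurable.of_discrete).aestronglyMeasurable
      (Eventually.of_forall fun a => ?_)
    have := changeBound_nonneg a
    rw [Real.norm_eq_abs, abs_of_nonneg (le_min (by positivity) (by positivity))]
    exact min_le_right _ _
  have hia : ∀ ℓ, Integrable (fun e : (Fin L → ℕ) × Channel L => (e.1 ℓ : ℝ)) (α.prod γ) :=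
    fun ℓ => (hα ℓ).comp_fst γ
  have his : ∀ ℓ, Integrable (fun e : (Fin L → ℕ) × Channel L => success P θ (π q) e.2 ℓ)
      (α.prod γ) := fun ℓ => (integrable_success (π q) ℓ).comp_snd α
  have hterm : ∀ ℓ, Integrable (fun e : (Fin L → ℕ) × Channel L =>
      (q ℓ : ℝ) * (e.1 ℓ - success P θ (π q) e.2 ℓ)) (α.prod γ) :=
    fun ℓ => ((hia ℓ).sub (his ℓ)).const_mul _
  have hlin : Integrable (fun e : (Fin L → ℕ) × Channel L =>
      (∑ ℓ, (q ℓ : ℝ) * (e.1 ℓ - success P θ (π q) e.2 ℓ)) / R) (α.prod γ) :=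
    (integrable_finsetSum _ fun ℓ _ => hterm ℓ).div_const _
  have hle := integral_mono (integrable_queueNorm_nextQueue hα q)
    (((integrable_const R).add hlin).add (hmin.comp_fst γ))
    fun e => queueNorm_nextQueue_le_linear hq e.1 e.2
  refine hle.trans ?_
  have hlinval : ∫ e : (Fin L → ℕ) × Channel L,
      (∑ ℓ, (q ℓ : ℝ) * (e.1 ℓ - success P θ (π q) e.2 ℓ)) / R ∂α.prod γ ≤ -δ := by
    rw [integral_div, integral_finsetSum _ fun ℓ _ => hterm ℓ, div_le_iff₀ hq]
    have hval : ∀ ℓ, ∫ e : (Fin L → ℕ) × Channel L,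
        (q ℓ : ℝ) * (e.1 ℓ - success P θ (π q) e.2 ℓ) ∂α.prod γ
        ≤ q ℓ * r' ℓ - q ℓ * δ - q ℓ * depVec P θ (π q) ℓ := by
      intro ℓ
      rw [integral_const_mul, integral_sub (hia ℓ) (his ℓ),
        integral_fun_fst (fun a : Fin L → ℕ => (a ℓ : ℝ)),
        integral_fun_snd (fun h : Channel L => success P θ (π q) h ℓ)]
      simp only [probReal_univ, one_smul]
      have h1 := hδ ℓ
      have h2 := depVec_le_integral_success hP hθ (π q) ℓ
      rw [← mul_sub, ← mul_sub]
      exact mul_le_mul_of_nonneg_left (by linarith) (Nat.cast_nonneg _)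
    refine (Finset.sum_le_sum fun ℓ _ => hval ℓ).trans ?_
    rw [Finset.sum_sub_distrib, Finset.sum_sub_distrib, ← Finset.sum_mul]
    have h1 := sum_mul_le_weight hπ hr' q
    have h2 : ∑ ℓ, (q ℓ : ℝ) * depVec P θ (π q) ℓ = weight P θ q (π q) := sum_mul_depVec q (π q)
    have h3 : R ≤ ∑ ℓ, (q ℓ : ℝ) := queueNorm_le_sum q
    nlinarith
  have h1 := integral_add ((integrable_const R).add hlin) (hmin.comp_fst γ)
  have h2 := integral_add (integrable_const (μ := α.prod γ) R) hlin
  have h3 := integral_fun_fst (μ := α) (ν := γ)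
    (fun a : Fin L → ℕ => min (changeBound a ^ 2 / (2 * R)) (2 * changeBound a))
  simp only [Pi.add_apply] at h1 h2
  simp only [Pi.add_apply]
  rw [h1, h2, h3, integral_const]
  simp only [probReal_univ, one_smul]
  linarith

end Drift

/-! ### The limit law of the queue lengths -/

section Stability

variable {L : ℕ} {P θ : ℝ} {π : Policy L}

/-- The policy of maximal weight schedules a nonempty queue unless all queues are empty. -/
lemma exists_mem_pos_of_isMaxWeight (hP : 0 < P) (hθ : 0 < θ) (hπ : IsMaxWeight P θ π)
    {q : Fin L → ℕ} (hq : q ≠ 0) : ∃ ℓ ∈ π q, 0 < q ℓ := by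
  obtain ⟨m, hm⟩ := Function.ne_iff.1 hq
  have hmpos : 0 < (q m : ℝ) := by exact_mod_cast Nat.pos_of_ne_zero hm
  have hL : 1 ≤ L := Nat.one_le_of_lt (Fin.pos m)
  have h1 : 0 < weight P θ q {m} := by
    rw [weight, Finset.card_singleton, Finset.sum_singleton]
    exact mul_pos (depRate_pos hP hθ hL) hmpos
  by_contra! h
  have h2 : weight P θ q (π q) = 0 := by
    rw [weight, Finset.sum_eq_zero fun ℓ hℓ => ?_, mul_zero]
    exact_mod_cast Nat.le_zero.1 (h ℓ hℓ)
  linarith [hπ q {m}]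

lemma sum_nextQueue_zero_lt {q : Fin L → ℕ} {ℓ : Fin L} (hℓ : ℓ ∈ π q) (hq : 0 < q ℓ)
    {h : Channel L} (hs : θ ≤ snr P h (π q) ℓ) :
    ∑ m, nextQueue P θ π q 0 h m < ∑ m, q m := by
  refine Finset.sum_lt_sum (fun m _ => ?_) ⟨ℓ, Finset.mem_univ ℓ, ?_⟩
  · simp [nextQueue]
  · simp only [nextQueue, hℓ, hs, and_self, if_true, Pi.zero_apply]
    omega

variable {α : Measure (Fin L → ℕ)}

/-- Without arrivals the total queue length decreases with positive probability. -/
lemma queueKernel_sum_lt_ne_zero (hP : 0 < P) (hθ : 0 < θ) (hπ : IsMaxWeight P θ π)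
    (hα0 : α {0} ≠ 0) {q : Fin L → ℕ} (hq : q ≠ 0) :
    queueKernel P θ π α q {q' | ∑ ℓ, q' ℓ < ∑ ℓ, q ℓ} ≠ 0 := by
  obtain ⟨ℓ, hℓ, hqℓ⟩ := exists_mem_pos_of_isMaxWeight hP hθ hπ hq
  rw [queueKernel, Measure.map_apply (measurable_nextQueue_apply q) .of_discrete]
  have hsub : ({0} : Set (Fin L → ℕ)) ×ˢ {h : Channel L | θ ≤ snr P h (π q) ℓ} ⊆
      (fun e : (Fin L → ℕ) × Channel L => nextQueue P θ π q e.1 e.2) ⁻¹'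
        {q' | ∑ ℓ, q' ℓ < ∑ ℓ, q ℓ} := by
    rintro ⟨a, h⟩ ⟨ha, hh⟩
    obtain rfl : a = 0 := ha
    exact sum_nextQueue_zero_lt hℓ hqℓ hh
  refine ne_of_gt (lt_of_lt_of_le ?_ (measure_mono hsub))
  rw [Measure.prod_prod]
  refine ENNReal.mul_pos hα0 (ne_of_gt (lt_of_lt_of_le ?_ (depRate_le_channelLaw hP hθ hℓ)))
  exact ENNReal.ofReal_pos.2 (depRate_pos hP hθ (by simpa using Finset.card_le_univ (π q)))

lemma queueKernel_zero_ne_zero (hα0 : α {0} ≠ 0) : queueKernel P θ π α 0 {0} ≠ 0 := by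
  rw [queueKernel, Measure.map_apply (measurable_nextQueue_apply 0) .of_discrete]
  have hsub : ({0} : Set (Fin L → ℕ)) ×ˢ (Set.univ : Set (Channel L)) ⊆
      (fun e : (Fin L → ℕ) × Channel L => nextQueue P θ π 0 e.1 e.2) ⁻¹' {0} := by
    rintro ⟨a, h⟩ ⟨ha, -⟩
    obtain rfl : a = 0 := ha
    ext ℓ
    simp [nextQueue]
  refine ne_of_gt (lt_of_lt_of_le ?_ (measure_mono hsub))
  rw [Measure.prod_prod, measure_univ, mul_one]
  exact pos_iff_ne_zero.2 hα0

/-- The queue-length process has a limit law if the arrival rates are strictly smaller than a vector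
of the stability region: the Euclidean norm is a Lyapunov function. (A quadratic function could have
an infinite drift, as the second moments of the arrivals may be infinite.) -/
theorem exists_queue_limit_law [IsProbabilityMeasure α] (hP : 0 < P) (hθ : 0 < θ)
    (hπ : IsMaxWeight P θ π)
    (hα : ∀ ℓ, Integrable (fun a : Fin L → ℕ => (a ℓ : ℝ)) α) (hα0 : α {0} ≠ 0)
    {r' : Fin L → ℝ} (hr' : r' ∈ stabilityRegion L P θ)
    (hlt : ∀ ℓ, ∫ a, (a ℓ : ℝ) ∂α < r' ℓ) :
    ∃ ν : Measure (Fin L → ℕ), IsProbabilityMeasure ν ∧ ∀ (s : Set (Fin L → ℕ)) q,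
      Tendsto (fun t => ((step (queueKernel P θ π α))^[t] (s.indicator 1) q).toReal) atTop
        (𝓝 (ν.real s)) := by
  obtain ⟨δ, hδ0, hδ⟩ : ∃ δ : ℝ, 0 < δ ∧ ∀ ℓ, ∫ a, (a ℓ : ℝ) ∂α + δ ≤ r' ℓ := by
    rcases isEmpty_or_nonempty (Fin L) with hL | hL
    · exact ⟨1, one_pos, fun ℓ => hL.elim ℓ⟩
    · obtain ⟨m, hm⟩ := Finite.exists_min fun ℓ => r' ℓ - ∫ a, (a ℓ : ℝ) ∂α
      exact ⟨r' m - ∫ a, (a m : ℝ) ∂α, sub_pos.2 (hlt m), fun ℓ => by linarith [hm ℓ]⟩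
  obtain ⟨R, hR⟩ := eventually_atTop.1 ((tendsto_integral_min_changeBound hα).eventually_lt_const
    (half_pos hδ0))
  have hB := integrable_changeBound hα
  have hint := integrable_queueNorm_nextQueue (P := P) (θ := θ) (π := π) hα
  have hstep : ∀ q, step (queueKernel P θ π α) (fun q => ENNReal.ofReal (queueNorm q)) q
      = ENNReal.ofReal (∫ e, queueNorm (nextQueue P θ π q e.1 e.2) ∂α.prod (channelLaw L)) := by
    intro q
    rw [step_queueKernel, ofReal_integral_eq_lintegral_ofReal (hint q)
      (Eventually.of_forall fun e => queueNorm_nonneg _)]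
  refine exists_limit_law_of_foster (o := 0) (φ := fun q => ∑ ℓ, q ℓ)
    (V := fun q => ENNReal.ofReal (queueNorm q)) (ε := ENNReal.ofReal (δ / 2))
    (b := ENNReal.ofReal (∫ a, changeBound a ∂α)) (C := {q | queueNorm q < max R 1})
    (queueKernel_zero_ne_zero hα0) (fun q hq => queueKernel_sum_lt_ne_zero hP hθ hπ hα0 hq)
    (ENNReal.ofReal_pos.2 (half_pos hδ0)).ne' ENNReal.ofReal_ne_top ENNReal.ofReal_ne_top
    (fun _ => ENNReal.ofReal_ne_top) (finite_queueNorm_lt _) (fun q hq => ?_) fun q => ?_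
  · have hq' : max R 1 ≤ queueNorm q := not_lt.1 hq
    have hq0 : 0 < queueNorm q := one_pos.trans_le ((le_max_right _ _).trans hq')
    have h1 := integral_queueNorm_le hP hθ hπ hα hr' hδ hδ0.le hq0
    have h2 := hR (queueNorm q) ((le_max_left _ _).trans hq')
    rw [hstep, ← ENNReal.ofReal_add (integral_nonneg fun _ => queueNorm_nonneg _)
      (half_pos hδ0).le]
    exact ENNReal.ofReal_le_ofReal (by linarith)
  · rw [hstep, ← ENNReal.ofReal_add (queueNorm_nonneg q)
      (integral_nonneg fun a => changeBound_nonneg a)]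
    refine ENNReal.ofReal_le_ofReal ?_
    have h1 := integral_mono (hint q) ((integrable_const (queueNorm q)).add (hB.comp_fst _))
      fun e => queueNorm_nextQueue_le q e.1 e.2
    have h2 := integral_add (integrable_const (μ := α.prod (channelLaw L)) (queueNorm q))
      (hB.comp_fst (channelLaw L))
    have h3 := integral_fun_fst (μ := α) (ν := channelLaw L) (changeBound (L := L))
    simp only [Pi.add_apply] at h1 h2
    rw [h2, h3, integral_const] at h1
    simpa using h1

/-! ### The queue lengths as a Markov chain -/

/-- The integral of a function of two independent random variables is an iterated integral. -/
lemma lintegral_indepFun {Ω β γ : Type*} [MeasurableSpace Ω] [MeasurableSpace β]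
    [MeasurableSpace γ] {μ : Measure Ω} [IsProbabilityMeasure μ] {X : Ω → β} {Y : Ω → γ}
    (hX : Measurable X) (hY : Measurable Y) (h : IndepFun X Y μ) {f : β × γ → ℝ≥0∞}
    (hf : Measurable f) :
    ∫⁻ ω, f (X ω, Y ω) ∂μ = ∫⁻ ω, ∫⁻ y, f (X ω, y) ∂μ.map Y ∂μ := by
  have : IsProbabilityMeasure (μ.map Y) := Measure.isProbabilityMeasure_map hY.aemeasurable
  have h1 := (indepFun_iff_map_prod_eq_prod_map_map hX.aemeasurable hY.aemeasurable).1 h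
  rw [← lintegral_map hf (hX.prodMk hY), h1, lintegral_prod _ hf.aemeasurable,
    lintegral_map hf.lintegral_prod_right' hX]

lemma measurable_queueLength {Ω : Type*} [MeasurableSpace Ω] {Q₀ : Ω → Fin L → ℕ}
    {A : ℕ → Ω → Fin L → ℕ} {H : ℕ → Ω → Channel L} (hQ : Measurable Q₀)
    (hA : ∀ t, Measurable (A t)) (hH : ∀ t, Measurable (H t)) (t : ℕ) :
    Measurable fun ω => queueLength P θ π (Q₀ ω) (fun s => A s ω) (fun s => H s ω) t := by
  induction t with
  | zero => exact hQ
  | succ t ih =>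
    exact (measurable_nextQueue P θ π).comp (ih.prodMk ((hA t).prodMk (hH t)))

lemma queueLength_congr {q₀ : Fin L → ℕ} {a a' : ℕ → Fin L → ℕ} {h h' : ℕ → Channel L} {t : ℕ}
    (ha : ∀ s < t, a s = a' s) (hh : ∀ s < t, h s = h' s) :
    queueLength P θ π q₀ a h t = queueLength P θ π q₀ a' h' t := by
  induction t with
  | zero => rfl
  | succ t ih =>
    rw [queueLength_succ, queueLength_succ, ha t t.lt_succ_self, hh t t.lt_succ_self,
      ih (fun s hs => ha s (hs.trans t.lt_succ_self)) fun s hs => hh s (hs.trans t.lt_succ_self)]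

variable {Ω : Type*} [MeasurableSpace Ω] {μ : Measure Ω}
  {r : Fin L → ℝ} {Q₀ : Ω → Fin L → ℕ} {A : ℕ → Ω → Fin L → ℕ} {H : ℕ → Ω → Channel L}

lemma IsInput.map_slot [IsProbabilityMeasure μ] (hin : IsInput μ r Q₀ A H) (t : ℕ) :
    μ.map (fun ω => (A t ω, H t ω)) = (μ.map (A 0)).prod (channelLaw L) := by
  rw [(indepFun_iff_map_prod_eq_prod_map_map (hin.measurable_arrival t).aemeasurable
    (hin.measurable_channel t).aemeasurable).1 (hin.indep_arrival_channel t), hin.arrival_law t,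
    hin.channel_law t]
  rfl

/-- The queue lengths at time `t` depend only on the earlier slots. -/
lemma IsInput.indepFun_queueLength (hin : IsInput μ r Q₀ A H) (q₀ : Fin L → ℕ) (t : ℕ) :
    IndepFun (fun ω => queueLength P θ π q₀ (fun s => A s ω) (fun s => H s ω) t)
      (fun ω => (A t ω, H t ω)) μ := by
  have hm : ∀ s, Measurable fun ω => (A s ω, H s ω) := fun s =>
    (hin.measurable_arrival s).prodMk (hin.measurable_channel s)
  have h := hin.indep_slots.indepFun_finset (Finset.range t) {t} (by simp) hm
  let G : (Finset.range t → (Fin L → ℕ) × Channel L) → Fin L → ℕ := fun y =>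
    queueLength P θ π q₀ (fun s => if hs : s ∈ Finset.range t then (y ⟨s, hs⟩).1 else 0)
      (fun s => if hs : s ∈ Finset.range t then (y ⟨s, hs⟩).2 else 0) t
  have hG : Measurable G := by
    refine measurable_queueLength (Q₀ := fun _ => q₀)
      (A := fun s (y : Finset.range t → (Fin L → ℕ) × Channel L) =>
        if hs : s ∈ Finset.range t then (y ⟨s, hs⟩).1 else 0)
      (H := fun s (y : Finset.range t → (Fin L → ℕ) × Channel L) =>
        if hs : s ∈ Finset.range t then (y ⟨s, hs⟩).2 else 0)
      measurable_const (fun s => ?_) (fun s => ?_) t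
    · split_ifs
      · exact (measurable_pi_apply _).fst
      · exact measurable_const
    · split_ifs
      · exact (measurable_pi_apply _).snd
      · exact measurable_const
  have h2 := h.comp hG (measurable_pi_apply (⟨t, by simp⟩ : ({t} : Finset ℕ)))
  have e : (fun ω => queueLength P θ π q₀ (fun s => A s ω) (fun s => H s ω) t)
      = G ∘ fun ω (i : Finset.range t) => (A i ω, H i ω) := by
    ext1 ω
    refine queueLength_congr (fun s hs => ?_) fun s hs => ?_
    · simp [hs]
    · simp [hs]
  rw [e]
  exact h2

/-- For fixed initial queue lengths, the queue-length process is a Markov chain. -/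
lemma IsInput.lintegral_queueLength_const [IsProbabilityMeasure μ]
    (hin : IsInput μ r Q₀ A H) (q₀ : Fin L → ℕ) (t : ℕ) (f : (Fin L → ℕ) → ℝ≥0∞) :
    ∫⁻ ω, f (queueLength P θ π q₀ (fun s => A s ω) (fun s => H s ω) t) ∂μ
      = (step (queueKernel P θ π (μ.map (A 0))))^[t] f q₀ := by
  induction t generalizing f with
  | zero => simp [queueLength]
  | succ t ih =>
    rw [Function.iterate_succ_apply, ← ih]
    have hX := measurable_queueLength (P := P) (θ := θ) (π := π) (Q₀ := fun _ : Ω => q₀)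
      measurable_const hin.measurable_arrival hin.measurable_channel t
    have h := lintegral_indepFun hX
      ((hin.measurable_arrival t).prodMk (hin.measurable_channel t))
      (hin.indepFun_queueLength (P := P) (θ := θ) (π := π) q₀ t)
      (f := fun z => f (nextQueue P θ π z.1 z.2.1 z.2.2))
      ((Measurable.of_discrete (f := f)).comp (measurable_nextQueue P θ π))
    simp only [queueLength_succ]
    rw [h, hin.map_slot t]
    refine lintegral_congr fun ω => ?_
    rw [step_queueKernel]

lemma IsInput.lintegral_queueLength [IsProbabilityMeasure μ] (hin : IsInput μ r Q₀ A H) (t : ℕ)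
    (f : (Fin L → ℕ) → ℝ≥0∞) :
    ∫⁻ ω, f (queueLength P θ π (Q₀ ω) (fun s => A s ω) (fun s => H s ω) t) ∂μ
      = ∫⁻ ω, (step (queueKernel P θ π (μ.map (A 0))))^[t] f (Q₀ ω) ∂μ := by
  have hm : Measurable fun ω (s : ℕ) => (A s ω, H s ω) := measurable_pi_lambda _ fun s =>
    (hin.measurable_arrival s).prodMk (hin.measurable_channel s)
  have hF : Measurable fun z : (Fin L → ℕ) × (ℕ → (Fin L → ℕ) × Channel L) =>
      f (queueLength P θ π z.1 (fun s => (z.2 s).1) (fun s => (z.2 s).2) t) :=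
    (Measurable.of_discrete (f := f)).comp
      (measurable_queueLength (Q₀ := fun z : (Fin L → ℕ) × (ℕ → (Fin L → ℕ) × Channel L) => z.1)
        (A := fun s z => (z.2 s).1) (H := fun s z => (z.2 s).2) measurable_fst
        (fun s => ((measurable_pi_apply s).comp measurable_snd).fst)
        (fun s => ((measurable_pi_apply s).comp measurable_snd).snd) t)
  refine (lintegral_indepFun hin.measurable_init hm hin.indep_init hF).trans
    (lintegral_congr fun ω => ?_)
  rw [← hin.lintegral_queueLength_const]
  exact lintegral_map (hF.comp measurable_prodMk_left) hm

/-! ### Stability -/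

theorem stabilizes_of_lt (hP : 0 < P) (hθ : 0 < θ) (hπ : IsMaxWeight P θ π) {r' : Fin L → ℝ}
    (hr' : r' ∈ stabilityRegion L P θ) (hlt : ∀ ℓ, r ℓ < r' ℓ) : Stabilizes.{u} P θ π r := by
  intro Ω _ μ _ Q₀ A H hin ℓ
  have hA := hin.measurable_arrival 0
  have : IsProbabilityMeasure (μ.map (A 0)) := Measure.isProbabilityMeasure_map hA.aemeasurable
  have hint : ∀ ℓ, Integrable (fun a : Fin L → ℕ => (a ℓ : ℝ)) (μ.map (A 0)) := fun ℓ =>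
    (integrable_map_measure (Measurable.of_discrete).aestronglyMeasurable hA.aemeasurable).2
      (hin.arrival_integrable ℓ)
  have hmean : ∀ ℓ, ∫ a, (a ℓ : ℝ) ∂μ.map (A 0) = r ℓ := fun ℓ =>
    (integral_map hA.aemeasurable (Measurable.of_discrete).aestronglyMeasurable).trans
      (hin.arrival_rate ℓ)
  have h0 : μ.map (A 0) {0} ≠ 0 := by
    rw [Measure.map_apply hA .of_discrete]
    exact hin.arrival_zero.ne'
  obtain ⟨ν, hν, hlim⟩ := exists_queue_limit_law hP hθ hπ hint h0 hr'
    fun ℓ => by rw [hmean]; exact hlt ℓ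
  refine ⟨fun x => ν.real {q | (q ℓ : ℝ) < x}, fun x => ?_, ?_⟩
  · set s : Set (Fin L → ℕ) := {q | (q ℓ : ℝ) < x}
    set κ := queueKernel P θ π (μ.map (A 0))
    have hs : s.indicator (1 : (Fin L → ℕ) → ℝ≥0∞) ≤ 1 := Set.indicator_le_self' fun _ _ => zero_le
    have hle : ∀ t q, (step κ)^[t] (s.indicator 1) q ≤ 1 := step_iterate_le_one hs
    have hprob : ∀ t, μ.real {ω | (queueLength P θ π (Q₀ ω) (fun s => A s ω)
        (fun s => H s ω) t ℓ : ℝ) < x}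
        = ∫ ω, ((step κ)^[t] (s.indicator 1) (Q₀ ω)).toReal ∂μ := by
      intro t
      have hX := measurable_queueLength (P := P) (θ := θ) (π := π) hin.measurable_init
        hin.measurable_arrival hin.measurable_channel t
      have hset : MeasurableSet {ω | (queueLength P θ π (Q₀ ω) (fun s => A s ω)
          (fun s => H s ω) t ℓ : ℝ) < x} := hX (MeasurableSet.of_discrete (s := s))
      have h1 := hin.lintegral_queueLength (P := P) (θ := θ) (π := π) t (s.indicator 1)
      have hmeas : Measurable fun ω => (step κ)^[t] (s.indicator 1) (Q₀ ω) :=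
        (Measurable.of_discrete (f := (step κ)^[t] (s.indicator 1))).comp hin.measurable_init
      rw [integral_toReal hmeas.aemeasurable (Eventually.of_forall fun ω =>
        (hle t _).trans_lt ENNReal.one_lt_top), ← h1, measureReal_def,
        ← lintegral_indicator_one hset]
      rfl
    simp_rw [hprob]
    have h := tendsto_integral_of_dominated_convergence (μ := μ) (fun _ => (1 : ℝ))
      (F := fun t ω => ((step κ)^[t] (s.indicator 1) (Q₀ ω)).toReal) (f := fun _ => ν.real s)
      (fun t => ((Measurable.of_discrete
        (f := fun q => ((step κ)^[t] (s.indicator 1) q).toReal)).comp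
          hin.measurable_init).aestronglyMeasurable) (integrable_const _)
      (fun t => Eventually.of_forall fun ω => ?_) (Eventually.of_forall fun ω => hlim s (Q₀ ω))
    · simpa using h
    · rw [Real.norm_eq_abs, abs_of_nonneg ENNReal.toReal_nonneg]
      simpa using ENNReal.toReal_mono ENNReal.one_ne_top (hle t (Q₀ ω))
  · have hmono : Monotone fun x : ℝ => {q : Fin L → ℕ | (q ℓ : ℝ) < x} :=
      fun x y hxy q hq => lt_of_lt_of_le hq hxy
    have hU : ⋃ x : ℝ, {q : Fin L → ℕ | (q ℓ : ℝ) < x} = Set.univ :=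
      Set.eq_univ_of_forall fun q => Set.mem_iUnion.2 ⟨q ℓ + 1, by simp⟩
    have h := tendsto_measure_iUnion_atTop (μ := ν) hmono
    rw [hU, measure_univ] at h
    simpa [measureReal_def, Function.comp_def] using
      (ENNReal.tendsto_toReal ENNReal.one_ne_top).comp h

/-! ### Boundary of the stability region -/

lemma convex_stabilityRegion : Convex ℝ (stabilityRegion L P θ) := by
  rintro r ⟨p, hp0, hp1, hr⟩ r' ⟨p', hp0', hp1', hr'⟩ a b ha hb hab
  refine ⟨fun v => a * p v + b * p' v, fun v => ?_, ?_, fun ℓ => ⟨?_, ?_⟩⟩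
  · have := hp0 v
    have := hp0' v
    positivity
  · rw [Finset.sum_add_distrib, ← Finset.mul_sum, ← Finset.mul_sum, hp1, hp1', mul_one, mul_one,
      hab]
  · have := (hr ℓ).1
    have := (hr' ℓ).1
    simp only [Pi.add_apply, Pi.smul_apply, smul_eq_mul]
    positivity
  · simp only [add_mul, Finset.sum_add_distrib, mul_assoc, ← Finset.mul_sum, Pi.add_apply,
      Pi.smul_apply, smul_eq_mul]
    exact add_le_add (mul_le_mul_of_nonneg_left (hr ℓ).2 ha)
      (mul_le_mul_of_nonneg_left (hr' ℓ).2 hb)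

lemma depVec_mem_stabilityRegion (hP : 0 < P) (hθ : 0 < θ) (v : Finset (Fin L)) :
    depVec P θ v ∈ stabilityRegion L P θ := by
  classical
  refine ⟨Pi.single v 1, fun w => ?_, by simp, fun ℓ => ⟨?_, ?_⟩⟩
  · by_cases hw : w = v
    · subst hw
      simp
    · simp [hw]
  · unfold depVec
    split_ifs
    · exact (depRate_pos hP hθ (by simpa using Finset.card_le_univ v)).le
    · exact le_rfl
  · simp [Pi.single_apply]

/-- Scheduling one user at a time serves all users at a positive rate. -/
lemma exists_pos_mem_stabilityRegion [Nonempty (Fin L)] (hP : 0 < P) (hθ : 0 < θ) :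
    ∃ c ∈ stabilityRegion L P θ, ∀ ℓ, 0 < c ℓ := by
  have hL : 0 < L := Fin.pos (Classical.arbitrary (Fin L))
  have hLR : (0 : ℝ) < L := by exact_mod_cast hL
  refine ⟨∑ m, (L : ℝ)⁻¹ • depVec P θ ({m} : Finset (Fin L)),
    convex_stabilityRegion.sum_mem (fun _ _ => by positivity) ?_
      fun m _ => depVec_mem_stabilityRegion hP hθ {m}, fun ℓ => ?_⟩
  · simp [hLR.ne']
  · have := depRate_pos (L := L) hP hθ hL
    simp only [Finset.sum_apply, Pi.smul_apply, smul_eq_mul, depVec, Finset.mem_singleton,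
      Finset.card_singleton, mul_ite, mul_zero, Finset.sum_ite_eq, Finset.mem_univ, if_true]
    positivity

/-- A vector of the stability region is approximated by its multiples `(1 - ε) r`, which are
strictly smaller than the mixture of `r` with a positive vector of the region. -/
theorem stabilityRegion_subset_closure (hP : 0 < P) (hθ : 0 < θ) (hπ : IsMaxWeight P θ π) :
    stabilityRegion L P θ ⊆ closure {r | (∀ ℓ, 0 ≤ r ℓ) ∧ Stabilizes.{u} P θ π r} := by
  intro r hr
  have hr0 : ∀ ℓ, 0 ≤ r ℓ := by
    obtain ⟨p, -, -, h⟩ := hr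
    exact fun ℓ => (h ℓ).1
  rcases isEmpty_or_nonempty (Fin L) with hL | hL
  · exact subset_closure ⟨hr0, stabilizes_of_lt hP hθ hπ hr fun ℓ => hL.elim ℓ⟩
  obtain ⟨c, hc, hc0⟩ := exists_pos_mem_stabilityRegion (L := L) hP hθ
  have hlim : Tendsto (fun ε : ℝ => (1 - ε) • r) (𝓝[>] 0) (𝓝 r) := by
    have h : Tendsto (fun ε : ℝ => (1 - ε) • r) (𝓝 0) (𝓝 ((1 - 0 : ℝ) • r)) :=
      Continuous.tendsto (by fun_prop) 0
    rw [sub_zero, one_smul] at h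
    exact h.mono_left nhdsWithin_le_nhds
  refine mem_closure_of_tendsto hlim ?_
  filter_upwards [Ioo_mem_nhdsGT (one_pos : (0 : ℝ) < 1)] with ε hε
  refine ⟨fun ℓ => mul_nonneg (sub_nonneg.2 hε.2.le) (hr0 ℓ), stabilizes_of_lt hP hθ hπ
    (convex_stabilityRegion hr hc (sub_nonneg.2 hε.2.le) hε.1.le (by ring)) fun ℓ => ?_⟩
  exact lt_add_of_pos_right _ (mul_pos hε.1 (hc0 ℓ))

end Stability

end SDMA

theorem proposition2 (L : ℕ) (P θ : ℝ) (hP : 0 < P) (hθ : 0 < θ)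
    (π : SDMA.Policy L) (hπ : SDMA.IsMaxWeight P θ π) :
    (∀ r : Fin L → ℝ, (∀ ℓ, 0 ≤ r ℓ) →
      (∃ r' ∈ SDMA.stabilityRegion L P θ, ∀ ℓ, r ℓ < r' ℓ) →
      SDMA.Stabilizes.{u} P θ π r) ∧
    SDMA.stabilityRegion L P θ ⊆
      closure {r | (∀ ℓ, 0 ≤ r ℓ) ∧ SDMA.Stabilizes.{u} P θ π r} :=
  ⟨fun _ _ ⟨_, hr', hlt⟩ => SDMA.stabilizes_of_lt hP hθ hπ hr' hlt,
    SDMA.stabilityRegion_subset_closure hP hθ hπ⟩
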